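/- Let $0<\Theta<2\pi$ and $Q=(0,1)\times(0,\Theta)$, with points written $(r,\theta)$. For a positive weight $w$ let $L^2_w(Q)$ be the space of measurable $v:Q\to\mathbb R$ with $\|v\|_{L^2_w(Q)}^2=\int_Q v^2\,w\,\mathrm dr\,\mathrm d\theta<\infty$; we use $w=r$ and $w=1/r$. All derivatives are weak derivatives. Let $\tilde H^1(Q)$ be the space of $v\in L^2_r(Q)$ with $\partial_r v\in L^2_r(Q)$ and $\partial_\theta v\in L^2_{1/r}(Q)$, normed by $$\|v\|_{\tilde H^1(Q)}^2=\|v\|_{L^2_r(Q)}^2+\|\partial_r v\|_{L^2_r(Q)}^2+\|\partial_\theta v\|_{L^2_{1/r}(Q)}^2 .$$ Let $U\subset\tilde H^1(Q)$ be the closure of $C^\infty(\overline Q)\cap\tilde H^1(Q)$ with respect to the norm $\|v\|_U=(\|v\|_{\tilde H^1(Q)}^2+\|\partial_{r\theta}v\|_{L^2_r(Q)}^2)^{1/2}$, and let $U'$ be the set of $u\in U$ with $\partial_{\theta\theta}u\in L^2_{1/r}(Q)$. Let $H^1_r(0,1)$ be the space of $g$ on $(0,1)$ with $\|g\|_{H^1_r(0,1)}^2=\int_0^1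 r\,(g^2+(g')^2)\,\mathrm dr<\infty$. For $0\le\vartheta\le\Theta$ let the radial trace $\gamma_\vartheta:U\to H^1_r(0,1)$ be the extension by continuity of the restriction map $\varphi\mapsto\varphi(\cdot,\vartheta)$ from $C^\infty(\overline Q)\cap\tilde H^1(Q)$ with the $U$-norm. For a partition $0=\theta_1<\theta_2<\dots<\theta_N=\Theta$ with mesh size $h=\max_i(\theta_{i+1}-\theta_i)$, let $e_1,\dots,e_N$ be the continuous piecewise linear functions on $[0,\Theta]$, linear on each $[\theta_i,\theta_{i+1}]$, with $e_i(\theta_j)=\delta_{ij}$, and for $u\in U$ let $$(\Pi u)(r,\theta)=\sum_{i=1}^N(\gamma_{\theta_i}u)(r)\,e_i(\theta).$$ **Theorem.** There is a constant $C>0$, independent of $u$ and of the partition, such that for every $u\in U'$ and every such partition the traces $\gamma_{\theta_i}u$ exist, $\Pi u\in\tilde H^1(Q)$, $$\|u-\Pi u\|_{L^2_r(Q)}\le h^2\,\|\partial_{\theta\theta}u\|_{L^2_{1/r}(Q)}$$ and $$\|u-\Pi u\|_{\tilde H^1(Q)}\le C\,h\left(\|\partial_{r\theta}u\|_{L^2_r(Q)}^2+\|\partial_{\theta\theta}u\|_{L^2_{1/r}(Q)}^2\right)^{1/2}.$$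 More precisely, $$\|u-\Pi u\|_{\tilde H^1(Q)}^2\le h^2(h^2+4)\left(\|\partial_{r\theta}u\|_{L^2_r(Q)}^2+\|\partial_{\theta\theta}u\|_{L^2_{1/r}(Q)}^2\right).$$ -/

import Mathlib

open MeasureTheory Set Filter Topology
open scoped ContDiff

namespace SBFEM

noncomputable section

/-! ### Weighted Lebesgue spaces and weak derivatives on an open set `Ω`
(used with `Ω = Q ⊆ ℝ × ℝ` and with `Ω = (0,1) ⊆ ℝ`). Functions are everywhere-defined
representatives; only their values almost everywhere on `Ω` matter. -/

section General

variable {E : Type*} [NormedAddCommGroup E] [NormedSpace ℝ E] [MeasureSpace E]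

/-- `v ∈ L²_w(Ω)`: `v` is (a.e.) measurable on `Ω` and `∫_Ω v² w < ∞`. -/
def MemL2 (Ω : Set E) (w : E → ℝ) (v : E → ℝ) : Prop :=
  AEStronglyMeasurable v (volume.restrict Ω) ∧ IntegrableOn (fun x => v x ^ 2 * w x) Ω

/-- The norm of `L²_w(Ω)`. -/
def normL2 (Ω : Set E) (w : E → ℝ) (v : E → ℝ) : ℝ :=
  Real.sqrt (∫ x in Ω, v x ^ 2 * w x)

/-- `g` is a weak derivative of `u` on `Ω` in the direction `e`. -/
def IsWeakDeriv (Ω : Set E) (e : E) (u g : E → ℝ) : Prop :=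
  LocallyIntegrableOn u Ω ∧ LocallyIntegrableOn g Ω ∧
    ∀ φ : E → ℝ, ContDiff ℝ ∞ φ → HasCompactSupport φ → tsupport φ ⊆ Ω →
      ∫ x in Ω, u x * fderiv ℝ φ x e = - ∫ x in Ω, g x * φ x

/-- `u` has a weak derivative on `Ω` in the direction `e`. -/
def WeaklyDifferentiable (Ω : Set E) (e : E) (u : E → ℝ) : Prop :=
  ∃ g, IsWeakDeriv Ω e u g

open Classical in
/-- The weak derivative of `u` on `Ω` in the direction `e` (it is unique almost everywhere on
an open `Ω`); the value is `0` if `u` has none. -/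
def weakDeriv (Ω : Set E) (e : E) (u : E → ℝ) : E → ℝ :=
  if h : WeaklyDifferentiable Ω e u then h.choose else 0

end General

/-! ### The rectangle `Q = (0,1) × (0,Θ)`, with points `(r, θ)`, and the function spaces on it -/

/-- The open rectangle `Q = (0,1) × (0,Θ)`. -/
def Q (Θ : ℝ) : Set (ℝ × ℝ) := Ioo 0 1 ×ˢ Ioo 0 Θ

/-- The weight `r` on `Q`. -/
def wr (p : ℝ × ℝ) : ℝ := p.1

/-- The weight `1/r` on `Q`. -/
def wrInv (p : ℝ × ℝ) : ℝ := 1 / p.1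

/-- The direction of `∂_r`. -/
def dirR : ℝ × ℝ := (1, 0)

/-- The direction of `∂_θ`. -/
def dirTheta : ℝ × ℝ := (0, 1)

/-- The weak derivative `∂_r u` on `Q`. -/
def dR (Θ : ℝ) (u : ℝ × ℝ → ℝ) : ℝ × ℝ → ℝ := weakDeriv (Q Θ) dirR u

/-- The weak derivative `∂_θ u` on `Q`. -/
def dTheta (Θ : ℝ) (u : ℝ × ℝ → ℝ) : ℝ × ℝ → ℝ := weakDeriv (Q Θ) dirTheta u

/-- The mixed weak derivative `∂_{rθ} u` on `Q`. -/
def dRTheta (Θ : ℝ) (u : ℝ × ℝ → ℝ) : ℝ × ℝ → ℝ := dTheta Θ (dR Θ u)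

/-- The second angular weak derivative `∂_{θθ} u` on `Q`. -/
def dThetaTheta (Θ : ℝ) (u : ℝ × ℝ → ℝ) : ℝ × ℝ → ℝ := dTheta Θ (dTheta Θ u)

/-- The weighted Sobolev space `H̃¹(Q)`: `v ∈ L²_r`, `∂_r v ∈ L²_r`, `∂_θ v ∈ L²_{1/r}`. -/
def MemH1 (Θ : ℝ) (v : ℝ × ℝ → ℝ) : Prop :=
  MemL2 (Q Θ) wr v ∧
  (WeaklyDifferentiable (Q Θ) dirR v ∧ MemL2 (Q Θ) wr (dR Θ v)) ∧
  (WeaklyDifferentiable (Q Θ) dirTheta v ∧ MemL2 (Q Θ) wrInv (dTheta Θ v))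

/-- The norm of `H̃¹(Q)`. -/
def normH1 (Θ : ℝ) (v : ℝ × ℝ → ℝ) : ℝ :=
  Real.sqrt (normL2 (Q Θ) wr v ^ 2 + normL2 (Q Θ) wr (dR Θ v) ^ 2
    + normL2 (Q Θ) wrInv (dTheta Θ v) ^ 2)

/-- The `U`-norm `(‖v‖²_{H̃¹(Q)} + ‖∂_{rθ} v‖²_{L²_r(Q)})^{1/2}`. -/
def normU (Θ : ℝ) (v : ℝ × ℝ → ℝ) : ℝ :=
  Real.sqrt (normH1 Θ v ^ 2 + normL2 (Q Θ) wr (dRTheta Θ v) ^ 2)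

/-- `C^∞(Q̄) ∩ H̃¹(Q)`, where `C^∞(Q̄)` consists of the restrictions to `Q̄` of smooth functions
on the plane. -/
def SmoothH1 (Θ : ℝ) (φ : ℝ × ℝ → ℝ) : Prop := ContDiff ℝ ∞ φ ∧ MemH1 Θ φ

/-- The space `U`: the closure of `C^∞(Q̄) ∩ H̃¹(Q)` in the `U`-norm. -/
def MemU (Θ : ℝ) (u : ℝ × ℝ → ℝ) : Prop :=
  MemH1 Θ u ∧
  (WeaklyDifferentiable (Q Θ) dirTheta (dR Θ u) ∧ MemL2 (Q Θ) wr (dRTheta Θ u)) ∧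
  ∃ φ : ℕ → ℝ × ℝ → ℝ, (∀ k, SmoothH1 Θ (φ k)) ∧
    Tendsto (fun k => normU Θ (φ k - u)) atTop (𝓝 0)

/-- The space `U'` of those `u ∈ U` with `∂_{θθ} u ∈ L²_{1/r}(Q)`. -/
def MemU' (Θ : ℝ) (u : ℝ × ℝ → ℝ) : Prop :=
  MemU Θ u ∧
  (WeaklyDifferentiable (Q Θ) dirTheta (dTheta Θ u) ∧ MemL2 (Q Θ) wrInv (dThetaTheta Θ u))

/-! ### The space `H¹_r(0,1)` and the radial trace operator -/

/-- The space `H¹_r(0,1)`: `g` and its weak derivative belong to `L²_r(0,1)`. -/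
def MemH1r (g : ℝ → ℝ) : Prop :=
  MemL2 (Ioo 0 1) (fun r => r) g ∧
  (WeaklyDifferentiable (Ioo 0 1) (1 : ℝ) g ∧
    MemL2 (Ioo 0 1) (fun r => r) (weakDeriv (Ioo 0 1) (1 : ℝ) g))

/-- The norm of `H¹_r(0,1)`. -/
def normH1r (g : ℝ → ℝ) : ℝ :=
  Real.sqrt (normL2 (Ioo 0 1) (fun r => r) g ^ 2
    + normL2 (Ioo 0 1) (fun r => r) (weakDeriv (Ioo 0 1) (1 : ℝ) g) ^ 2)

/-- `g` is the value at `u ∈ U` of the extension by continuity (from `C^∞(Q̄) ∩ H̃¹(Q)` with the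
`U`-norm, into `H¹_r(0,1)`) of the restriction operator `φ ↦ φ(·, ϑ)`. -/
def IsRadialTrace (Θ ϑ : ℝ) (u : ℝ × ℝ → ℝ) (g : ℝ → ℝ) : Prop :=
  MemU Θ u ∧ MemH1r g ∧
  ∃ φ : ℕ → ℝ × ℝ → ℝ, (∀ k, SmoothH1 Θ (φ k)) ∧
    Tendsto (fun k => normU Θ (φ k - u)) atTop (𝓝 0) ∧
    Tendsto (fun k => normH1r (fun r => φ k (r, ϑ) - g r)) atTop (𝓝 0)

open Classical in
/-- The radial trace `γ_ϑ u`; the value is `0` if there is none. -/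
def radialTrace (Θ ϑ : ℝ) (u : ℝ × ℝ → ℝ) : ℝ → ℝ :=
  if h : ∃ g, IsRadialTrace Θ ϑ u g then h.choose else 0

/-! ### Partitions, piecewise linear basis functions and the interpolant -/

/-- A partition `0 = θ₀ < θ₁ < ⋯ < θₙ = Θ`; only `node 0, …, node n` are used. -/
structure AngularPartition (Θ : ℝ) where
  n : ℕ
  node : ℕ → ℝ
  node_zero : node 0 = 0
  node_last : node n = Θ
  node_lt : ∀ i, i < n → node i < node (i + 1)

/-- The mesh size `h = max_i (θ_{i+1} - θ_i)`. -/
def AngularPartition.meshSize {Θ : ℝ} (T : AngularPartition Θ) : ℝ :=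
  ⨆ i : Fin T.n, (T.node ((i : ℕ) + 1) - T.node (i : ℕ))

/-- The continuous piecewise linear basis function `e_i` on `[0,Θ]`, with `e_i(θ_j) = δ_{ij}`. -/
def AngularPartition.hat {Θ : ℝ} (T : AngularPartition Θ) (i : ℕ) (θ : ℝ) : ℝ :=
  max 0 (min
    (if i = 0 then 1 else (θ - T.node (i - 1)) / (T.node i - T.node (i - 1)))
    (if i = T.n then 1 else (T.node (i + 1) - θ) / (T.node (i + 1) - T.node i)))

/-- The interpolant `(Π u)(r,θ) = ∑_i (γ_{θ_i} u)(r) e_i(θ)`. -/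
def interpolant {Θ : ℝ} (T : AngularPartition Θ) (u : ℝ × ℝ → ℝ) : ℝ × ℝ → ℝ :=
  fun p => ∑ i ∈ Finset.range (T.n + 1), radialTrace Θ (T.node i) u p.1 * T.hat i p.2

end

end SBFEM

/-!
The weights depend on `r` only, so `u` can be studied on almost every ray: there it is absolutely
continuous in `θ`, and `u(r, θ) = (γ_ϑ u)(r) + ∫_ϑ^θ ∂_θ u(r, t) dt`. Trace estimates follow from
this identity, and it persists under the closure in the `U`-norm.

On an angular element, `∂_θ (u - Πu)` is the deviation of `∂_θ u` from its average over the element,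
so `u - Πu` is the angular primitive of that deviation, and this primitive vanishes at the nodes.
In `L²`, the deviation of `f` from its averages is at most `‖f‖` and at most `h ‖f'‖`, and a
primitive vanishing at the nodes is at most `h` times its integrand. For `f = ∂_θ u` these two
factors `h` give the `L²_r` and the angular estimates. Since `Π` acts in `θ` only, it commutes with
`∂_r`, and `f = ∂_{rθ} u` gives the radial estimate.
-/

namespace SBFEM

section Integral

variable {α : Type*} [MeasurableSpace α] {μ : Measure α} {f g : α → ℝ}

theorem abs_integral_mul_le_lpNorm_mul_lpNorm (hf : MemLp f 2 μ) (hg : MemLp g 2 μ) :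
    |∫ x, f x * g x ∂μ| ≤ lpNorm f 2 μ * lpNorm g 2 μ := by
  have inner_eq : inner ℝ (hf.toLp f) (hg.toLp g) = ∫ x, f x * g x ∂μ := by
    rw [L2.inner_def]
    refine integral_congr_ae ?_
    filter_upwards [hf.coeFn_toLp, hg.coeFn_toLp] with x hfx hgx
    simp [hfx, hgx, mul_comm]
  have cauchy_schwarz := abs_real_inner_le_norm (hf.toLp f) (hg.toLp g)
  rwa [inner_eq, Lp.norm_toLp, Lp.norm_toLp, toReal_eLpNorm hf.1, toReal_eLpNorm hg.1]
    at cauchy_schwarz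

theorem lpNorm_two_sq (hf : AEStronglyMeasurable f μ) : lpNorm f 2 μ ^ 2 = ∫ x, f x ^ 2 ∂μ := by
  rw [lpNorm_eq_integral_norm_rpow_toReal two_ne_zero ENNReal.ofNat_ne_top hf,
    ENNReal.toReal_ofNat, ← Real.rpow_natCast, ← Real.rpow_mul (by positivity)]
  simp

theorem sq_integral_le_measureReal_mul [IsFiniteMeasure μ] (hf : MemLp f 2 μ) :
    (∫ x, f x ∂μ) ^ 2 ≤ μ.real univ * ∫ x, f x ^ 2 ∂μ := by
  have cauchy_schwarz := pow_le_pow_left₀ (abs_nonneg _)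
    (abs_integral_mul_le_lpNorm_mul_lpNorm (memLp_const (1 : ℝ)) hf) 2
  rw [mul_pow, lpNorm_two_sq aestronglyMeasurable_const, lpNorm_two_sq hf.1] at cauchy_schwarz
  simpa using cauchy_schwarz

theorem integral_sub_average_sq [IsFiniteMeasure μ] (hf : MemLp f 2 μ) (k : ℝ) :
    ∫ x, (f x - ⨍ y, f y ∂μ) ^ 2 ∂μ ≤ ∫ x, (f x - k) ^ 2 ∂μ := by
  set a := ⨍ y, f y ∂μ
  have hfa : MemLp (fun x => f x - a) 2 μ := hf.sub (memLp_const a)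
  have orthogonal : ∫ x, (f x - a) ∂μ = 0 := integral_sub_average μ f
  have pythagoras : ∫ x, (f x - k) ^ 2 ∂μ
      = ∫ x, (f x - a) ^ 2 ∂μ + μ.real univ * (a - k) ^ 2 := by
    calc ∫ x, (f x - k) ^ 2 ∂μ
        = ∫ x, ((f x - a) ^ 2 + (2 * (a - k) * (f x - a) + (a - k) ^ 2)) ∂μ := by
          congr with x; ring
      _ = _ := by
          have hlin : Integrable (fun x => 2 * (a - k) * (f x - a)) μ :=
            (hfa.integrable one_le_two).const_mul _
          rw [integral_add hfa.integrable_sq (by fun_prop), integral_add hlin (integrable_const _),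
            integral_const_mul, orthogonal, integral_const]
          simp
  rw [pythagoras]
  exact le_add_of_nonneg_right (by positivity)

end Integral

section WeightedL2

variable {X : Type*} {Ω : Set X} {w w' u v ψ : X → ℝ}

section MeasureSpace

variable [MeasureSpace X]

theorem MemL2.congr (hu : MemL2 Ω w u) (h : u =ᵐ[volume.restrict Ω] v) : MemL2 Ω w v :=
  ⟨hu.1.congr h, hu.2.congr (h.mono fun x hx => by simp only [hx])⟩

theorem normL2_congr (h : u =ᵐ[volume.restrict Ω] v) : normL2 Ω w u = normL2 Ω w v := by
  unfold normL2
  congr 1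
  exact integral_congr_ae (h.mono fun x hx => by simp only [hx])

theorem MemL2.neg (hv : MemL2 Ω w v) : MemL2 Ω w (-v) :=
  ⟨hv.1.neg, hv.2.congr (ae_of_all _ fun x => by simp)⟩

theorem normL2_nonneg : 0 ≤ normL2 Ω w v :=
  Real.sqrt_nonneg _

end MeasureSpace

variable [TopologicalSpace X]

/-- A continuous positive weight on an open set: the weights for which `L²_w(Ω)` embeds into
`L¹_loc(Ω)`, so that its elements may be tested against smooth functions. -/
structure IsWeight (Ω : Set X) (w : X → ℝ) : Prop where
  isOpen : IsOpen Ω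
  continuousOn : ContinuousOn w Ω
  pos : ∀ x ∈ Ω, 0 < w x

namespace IsWeight

theorem inv (hw : IsWeight Ω w) : IsWeight Ω w⁻¹ :=
  ⟨hw.isOpen, hw.continuousOn.inv₀ fun x hx => (hw.pos x hx).ne',
    fun x hx => inv_pos.2 (hw.pos x hx)⟩

theorem continuousOn_sqrt (hw : IsWeight Ω w) : ContinuousOn (fun x => √(w x)) Ω :=
  hw.continuousOn.sqrt

theorem sqrt_ne_zero (hw : IsWeight Ω w) {x : X} (hx : x ∈ Ω) : √(w x) ≠ 0 :=
  (Real.sqrt_pos.2 (hw.pos x hx)).ne'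

variable [MeasureSpace X] [OpensMeasurableSpace X]

theorem measurableSet (hw : IsWeight Ω w) : MeasurableSet Ω :=
  hw.isOpen.measurableSet

theorem aestronglyMeasurable (hw : IsWeight Ω w) : AEStronglyMeasurable w (volume.restrict Ω) :=
  hw.continuousOn.aestronglyMeasurable hw.measurableSet

theorem ae_sq_mul_sqrt (hw : IsWeight Ω w) (v : X → ℝ) :
    (fun x => (v x * √(w x)) ^ 2) =ᵐ[volume.restrict Ω] fun x => v x ^ 2 * w x := by
  filter_upwards [ae_restrict_mem hw.measurableSet] with x hx
  rw [mul_pow, Real.sq_sqrt (hw.pos x hx).le]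

theorem memL2_iff_memLp (hw : IsWeight Ω w) :
    MemL2 Ω w v ↔ MemLp (fun x => v x * √(w x)) 2 (volume.restrict Ω) := by
  have hsqrt := hw.continuousOn_sqrt.aestronglyMeasurable (μ := volume) hw.measurableSet
  constructor
  · exact fun hv => (memLp_two_iff_integrable_sq (hv.1.mul hsqrt)).2
      (hv.2.congr (hw.ae_sq_mul_sqrt v).symm)
  · refine fun hv => ⟨(hv.1.mul hsqrt.aemeasurable.inv.aestronglyMeasurable).congr ?_,
      hv.integrable_sq.congr (hw.ae_sq_mul_sqrt v)⟩
    filter_upwards [ae_restrict_mem hw.measurableSet] with x hx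
    exact mul_inv_cancel_right₀ (hw.sqrt_ne_zero hx) (v x)

theorem normL2_sq (hw : IsWeight Ω w) : normL2 Ω w v ^ 2 = ∫ x in Ω, v x ^ 2 * w x :=
  Real.sq_sqrt (setIntegral_nonneg hw.measurableSet fun x hx =>
    mul_nonneg (sq_nonneg _) (hw.pos x hx).le)

theorem normL2_eq_lpNorm (hw : IsWeight Ω w) (hv : MemL2 Ω w v) :
    normL2 Ω w v = lpNorm (fun x => v x * √(w x)) 2 (volume.restrict Ω) := by
  rw [normL2, ← integral_congr_ae (hw.ae_sq_mul_sqrt v),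
    ← lpNorm_two_sq (hw.memL2_iff_memLp.1 hv).1, Real.sqrt_sq lpNorm_nonneg]

end IsWeight

variable [MeasureSpace X] [OpensMeasurableSpace X]

theorem MemL2.of_sq_mul_le (hw : IsWeight Ω w) (hv : AEStronglyMeasurable v (volume.restrict Ω))
    {F : X → ℝ} (hF : IntegrableOn F Ω) (hle : ∀ᵐ x ∂volume.restrict Ω, v x ^ 2 * w x ≤ F x) :
    MemL2 Ω w v := by
  refine ⟨hv, hF.mono' ((hv.pow 2).mul hw.aestronglyMeasurable) ?_⟩
  filter_upwards [hle, ae_restrict_mem hw.measurableSet] with x hx hxΩ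
  rwa [Real.norm_of_nonneg (mul_nonneg (sq_nonneg _) (hw.pos x hxΩ).le)]

theorem MemL2.mono_weight (hw : IsWeight Ω w) (hle : ∀ x ∈ Ω, w x ≤ w' x) (hv : MemL2 Ω w' v) :
    MemL2 Ω w v := by
  refine MemL2.of_sq_mul_le hw hv.1 hv.2 ?_
  filter_upwards [ae_restrict_mem hw.measurableSet] with x hx
  exact mul_le_mul_of_nonneg_left (hle x hx) (sq_nonneg _)

theorem MemL2.add (hw : IsWeight Ω w) (hu : MemL2 Ω w u) (hv : MemL2 Ω w v) :
    MemL2 Ω w (u + v) := by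
  rw [hw.memL2_iff_memLp] at *
  convert hu.add hv using 1
  exact funext fun x => add_mul _ _ _

theorem MemL2.sub (hw : IsWeight Ω w) (hu : MemL2 Ω w u) (hv : MemL2 Ω w v) :
    MemL2 Ω w (u - v) := by
  rw [sub_eq_add_neg]
  exact hu.add hw hv.neg

theorem normL2_sub_le (hw : IsWeight Ω w) (hu : MemL2 Ω w u) (hv : MemL2 Ω w v) :
    normL2 Ω w (u - v) ≤ normL2 Ω w u + normL2 Ω w v := by
  rw [hw.normL2_eq_lpNorm (hu.sub hw hv), hw.normL2_eq_lpNorm hu, hw.normL2_eq_lpNorm hv]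
  convert lpNorm_sub_le (hw.memL2_iff_memLp.1 hu) one_le_two using 3 with x
  simp [sub_mul]

theorem ae_eq_of_tendsto_normL2_sub (hw : IsWeight Ω w) {U : ℕ → X → ℝ}
    (hU : ∀ k, MemL2 Ω w (U k)) (hu : MemL2 Ω w u) (hv : MemL2 Ω w v)
    (hlimu : Tendsto (fun k => normL2 Ω w (U k - u)) atTop (𝓝 0))
    (hlimv : Tendsto (fun k => normL2 Ω w (U k - v)) atTop (𝓝 0)) :
    u =ᵐ[volume.restrict Ω] v := by
  have triangle (k : ℕ) : normL2 Ω w (u - v) ≤ normL2 Ω w (U k - v) + normL2 Ω w (U k - u) := by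
    rw [← sub_sub_sub_cancel_left v u (U k)]
    exact normL2_sub_le hw ((hU k).sub hw hv) ((hU k).sub hw hu)
  have hzero : normL2 Ω w (u - v) = 0 :=
    le_antisymm (ge_of_tendsto' (by simpa using hlimv.add hlimu) triangle) normL2_nonneg
  have hmem := hu.sub hw hv
  rw [hw.normL2_eq_lpNorm hmem, lpNorm_eq_zero (hw.memL2_iff_memLp.1 hmem) two_ne_zero] at hzero
  filter_upwards [hzero, ae_restrict_mem hw.measurableSet] with x hx hxΩ
  exact sub_eq_zero.1 ((mul_eq_zero.1 hx).resolve_right (hw.sqrt_ne_zero hxΩ))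

theorem ae_mul_sqrt_mul_mul_sqrt_inv (hw : IsWeight Ω w) (u ψ : X → ℝ) :
    ∀ᵐ x ∂volume.restrict Ω, u x * √(w x) * (ψ x * √(w⁻¹ x)) = u x * ψ x := by
  filter_upwards [ae_restrict_mem hw.measurableSet] with x hx
  have := hw.sqrt_ne_zero hx
  rw [Pi.inv_apply, Real.sqrt_inv]
  field_simp

theorem MemL2.integrableOn_mul (hw : IsWeight Ω w) (hu : MemL2 Ω w u) (hψ : MemL2 Ω w⁻¹ ψ) :
    IntegrableOn (fun x => u x * ψ x) Ω :=
  ((hw.memL2_iff_memLp.1 hu).integrable_mul (hw.inv.memL2_iff_memLp.1 hψ)).congr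
    (ae_mul_sqrt_mul_mul_sqrt_inv hw u ψ)

theorem abs_setIntegral_mul_le_normL2_mul_normL2_inv (hw : IsWeight Ω w) (hu : MemL2 Ω w u)
    (hψ : MemL2 Ω w⁻¹ ψ) :
    |∫ x in Ω, u x * ψ x| ≤ normL2 Ω w u * normL2 Ω w⁻¹ ψ := by
  rw [hw.normL2_eq_lpNorm hu, hw.inv.normL2_eq_lpNorm hψ,
    ← integral_congr_ae (ae_mul_sqrt_mul_mul_sqrt_inv hw u ψ)]
  exact abs_integral_mul_le_lpNorm_mul_lpNorm (hw.memL2_iff_memLp.1 hu)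
    (hw.inv.memL2_iff_memLp.1 hψ)

theorem tendsto_setIntegral_mul (hw : IsWeight Ω w) {U : ℕ → X → ℝ} (hU : ∀ k, MemL2 Ω w (U k))
    (hu : MemL2 Ω w u) (hlim : Tendsto (fun k => normL2 Ω w (U k - u)) atTop (𝓝 0))
    (hψ : MemL2 Ω w⁻¹ ψ) :
    Tendsto (fun k => ∫ x in Ω, U k x * ψ x) atTop (𝓝 (∫ x in Ω, u x * ψ x)) := by
  rw [tendsto_iff_norm_sub_tendsto_zero]
  refine squeeze_zero (fun k => norm_nonneg _) (fun k => ?_)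
    (by simpa using hlim.mul_const (normL2 Ω w⁻¹ ψ))
  rw [← integral_sub ((hU k).integrableOn_mul hw hψ) (hu.integrableOn_mul hw hψ), Real.norm_eq_abs]
  simpa only [Pi.sub_apply, sub_mul] using
    abs_setIntegral_mul_le_normL2_mul_normL2_inv hw ((hU k).sub hw hu) hψ

theorem memL2_of_continuous_of_tsupport_subset [T2Space X]
    [IsFiniteMeasureOnCompacts (volume : Measure X)] (hw : IsWeight Ω w)
    (hψ : Continuous ψ) (hc : HasCompactSupport ψ) (hs : tsupport ψ ⊆ Ω) : MemL2 Ω w ψ := by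
  refine ⟨(hψ.continuousOn (s := Ω)).aestronglyMeasurable hw.measurableSet, ?_⟩
  have hcont : ContinuousOn (fun x => ψ x ^ 2 * w x) (tsupport ψ) :=
    (hψ.pow 2).continuousOn.mul (hw.continuousOn.mono hs)
  refine ((integrableOn_iff_integrable_of_support_subset fun x hx => ?_).1
    (hcont.integrableOn_compact hc)).integrableOn
  exact subset_tsupport ψ (pow_ne_zero_iff two_ne_zero |>.1 (left_ne_zero_of_mul hx))

theorem MemL2.locallyIntegrableOn [T2Space X] [LocallyCompactSpace X]
    [IsFiniteMeasureOnCompacts (volume : Measure X)] (hw : IsWeight Ω w) (hu : MemL2 Ω w u) :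
    LocallyIntegrableOn u Ω := by
  rw [locallyIntegrableOn_iff hw.isOpen.isLocallyClosed]
  intro K hK hKc
  have hinv : MemLp (fun x => √(w⁻¹ x)) 2 (volume.restrict K) := by
    refine (memLp_two_iff_integrable_sq ?_).2 ?_
    · exact (hw.inv.continuousOn_sqrt.mono hK).aestronglyMeasurable hKc.measurableSet
    · exact ((hw.inv.continuousOn_sqrt.mono hK).pow 2).integrableOn_compact hKc
  have hu' := (hw.memL2_iff_memLp.1 hu).mono_measure (Measure.restrict_mono hK le_rfl)
  refine (hu'.integrable_mul hinv).congr ?_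
  filter_upwards [ae_restrict_of_ae_restrict_of_subset hK
    (ae_mul_sqrt_mul_mul_sqrt_inv hw u 1)] with x hx
  simpa using hx

end WeightedL2

section WeakDerivative

variable {E : Type*} [NormedAddCommGroup E] {Ω : Set E} {e : E} {w u v g h ψ φ : E → ℝ}

theorem continuous_fderiv_apply_const [NormedSpace ℝ E] (hφ : ContDiff ℝ ∞ φ) (e : E) :
    Continuous fun x => fderiv ℝ φ x e :=
  (hφ.continuous_fderiv (by simp)).clm_apply continuous_const

variable [MeasureSpace E]

theorem setIntegral_mul_eq_integral_of_tsupport_subset (u : E → ℝ) (hs : tsupport ψ ⊆ Ω) :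
    ∫ x in Ω, u x * ψ x = ∫ x, u x * ψ x :=
  setIntegral_eq_integral_of_forall_compl_eq_zero fun x hx => by
    rw [image_eq_zero_of_notMem_tsupport fun hx' => hx (hs hx'), mul_zero]

theorem integrable_mul_of_tsupport_subset [OpensMeasurableSpace E] (hu : LocallyIntegrableOn u Ω)
    (hψ : Continuous ψ) (hc : HasCompactSupport ψ) (hs : tsupport ψ ⊆ Ω) :
    Integrable (fun x => u x * ψ x) := by
  have hK : IntegrableOn (fun x => u x * ψ x) (tsupport ψ) :=
    (hu.integrableOn_compact_subset hs hc).mul_continuousOn hψ.continuousOn hc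
  refine (integrableOn_iff_integrable_of_support_subset fun x hx => ?_).1 hK
  exact subset_tsupport _ (right_ne_zero_of_mul hx)

variable [NormedSpace ℝ E]

theorem IsWeakDeriv.congr (hu : IsWeakDeriv Ω e u g) (huv : u =ᵐ[volume.restrict Ω] v)
    (hgh : g =ᵐ[volume.restrict Ω] h) : IsWeakDeriv Ω e v h := by
  refine ⟨hu.1.congr huv, hu.2.1.congr hgh, fun φ hφ hc hs => ?_⟩
  exact (integral_congr_ae (huv.symm.mul .rfl)).trans <| (hu.2.2 φ hφ hc hs).trans <|
    congrArg Neg.neg (integral_congr_ae (hgh.mul .rfl))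

theorem IsWeakDeriv.neg (hu : IsWeakDeriv Ω e u g) : IsWeakDeriv Ω e (-u) (-g) := by
  refine ⟨hu.1.neg, hu.2.1.neg, fun φ hφ hc hs => ?_⟩
  simp only [Pi.neg_apply, neg_mul, integral_neg, hu.2.2 φ hφ hc hs]

theorem isWeakDeriv_zero : IsWeakDeriv Ω e (0 : E → ℝ) 0 :=
  ⟨locallyIntegrableOn_zero, locallyIntegrableOn_zero, fun φ _ _ _ => by simp⟩

theorem WeaklyDifferentiable.isWeakDeriv_weakDeriv (hu : WeaklyDifferentiable Ω e u) :
    IsWeakDeriv Ω e u (weakDeriv Ω e u) := by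
  rw [weakDeriv, dif_pos hu]
  exact hu.choose_spec

variable [OpensMeasurableSpace E]

theorem IsWeakDeriv.integrable_mul_fderiv (hu : IsWeakDeriv Ω e u g) (hφ : ContDiff ℝ ∞ φ)
    (hc : HasCompactSupport φ) (hs : tsupport φ ⊆ Ω) :
    Integrable fun x => u x * fderiv ℝ φ x e :=
  integrable_mul_of_tsupport_subset hu.1 (continuous_fderiv_apply_const hφ e)
    (hc.fderiv_apply ℝ e) ((tsupport_fderiv_apply_subset ℝ e).trans hs)

theorem IsWeakDeriv.integrable_mul (hu : IsWeakDeriv Ω e u g) (hφ : ContDiff ℝ ∞ φ)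
    (hc : HasCompactSupport φ) (hs : tsupport φ ⊆ Ω) : Integrable fun x => g x * φ x :=
  integrable_mul_of_tsupport_subset hu.2.1 hφ.continuous hc hs

theorem IsWeakDeriv.add (hu : IsWeakDeriv Ω e u g) (hv : IsWeakDeriv Ω e v h) :
    IsWeakDeriv Ω e (u + v) (g + h) := by
  refine ⟨hu.1.add hv.1, hu.2.1.add hv.2.1, fun φ hφ hc hs => ?_⟩
  simp only [Pi.add_apply, add_mul]
  rw [integral_add (hu.integrable_mul_fderiv hφ hc hs).integrableOn
      (hv.integrable_mul_fderiv hφ hc hs).integrableOn,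
    integral_add (hu.integrable_mul hφ hc hs).integrableOn
      (hv.integrable_mul hφ hc hs).integrableOn, hu.2.2 φ hφ hc hs, hv.2.2 φ hφ hc hs]
  ring

theorem IsWeakDeriv.sub (hu : IsWeakDeriv Ω e u g) (hv : IsWeakDeriv Ω e v h) :
    IsWeakDeriv Ω e (u - v) (g - h) := by
  rw [sub_eq_add_neg, sub_eq_add_neg]
  exact hu.add hv.neg

theorem IsWeakDeriv.sum {ι : Type*} (s : Finset ι) {U G : ι → E → ℝ}
    (hU : ∀ i ∈ s, IsWeakDeriv Ω e (U i) (G i)) :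
    IsWeakDeriv Ω e (∑ i ∈ s, U i) (∑ i ∈ s, G i) := by
  classical
  induction s using Finset.induction_on with
  | empty => simpa using isWeakDeriv_zero
  | insert a s ha ih =>
    rw [Finset.sum_insert ha, Finset.sum_insert ha]
    exact (hU a (by simp)).add (ih fun i hi => hU i (by simp [hi]))

theorem IsWeakDeriv.of_tendsto [LocallyCompactSpace E]
    [IsFiniteMeasureOnCompacts (volume : Measure E)] (hw : IsWeight Ω w) {U G : ℕ → E → ℝ}
    (hUG : ∀ k, IsWeakDeriv Ω e (U k) (G k)) (hU : ∀ k, MemL2 Ω w (U k)) (hu : MemL2 Ω w u)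
    (hG : ∀ k, MemL2 Ω w (G k)) (hg : MemL2 Ω w g)
    (hlimU : Tendsto (fun k => normL2 Ω w (U k - u)) atTop (𝓝 0))
    (hlimG : Tendsto (fun k => normL2 Ω w (G k - g)) atTop (𝓝 0)) : IsWeakDeriv Ω e u g := by
  refine ⟨hu.locallyIntegrableOn hw, hg.locallyIntegrableOn hw, fun φ hφ hc hs => ?_⟩
  have limU := tendsto_setIntegral_mul hw hU hu hlimU <|
    memL2_of_continuous_of_tsupport_subset hw.inv (continuous_fderiv_apply_const hφ e)
      (hc.fderiv_apply ℝ e) ((tsupport_fderiv_apply_subset ℝ e).trans hs)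
  have limG := tendsto_setIntegral_mul hw hG hg hlimG <|
    memL2_of_continuous_of_tsupport_subset hw.inv hφ.continuous hc hs
  exact tendsto_nhds_unique limU (limG.neg.congr fun k => ((hUG k).2.2 φ hφ hc hs).symm)

variable [FiniteDimensional ℝ E] [BorelSpace E]

theorem IsWeakDeriv.ae_eq (hΩ : IsOpen Ω) (hu : IsWeakDeriv Ω e u g) (hv : IsWeakDeriv Ω e v h)
    (huv : u =ᵐ[volume.restrict Ω] v) : g =ᵐ[volume.restrict Ω] h := by
  have hdiff := (hu.congr huv (EventuallyEq.refl _ g)).sub hv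
  have hzero : ∀ᵐ x ∂volume, x ∈ Ω → (g - h) x = 0 := by
    refine hΩ.ae_eq_zero_of_integral_contDiff_smul_eq_zero hdiff.2.1 fun φ hφ hc hs => ?_
    have htest := hdiff.2.2 φ hφ hc hs
    rw [setIntegral_mul_eq_integral_of_tsupport_subset _ hs] at htest
    simpa [mul_comm] using htest
  filter_upwards [(ae_restrict_iff' hΩ.measurableSet).2 hzero] with x hx
  exact sub_eq_zero.1 hx

theorem IsWeakDeriv.weakDeriv_ae_eq (hΩ : IsOpen Ω) (hu : IsWeakDeriv Ω e u g) :
    weakDeriv Ω e u =ᵐ[volume.restrict Ω] g :=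
  (WeaklyDifferentiable.isWeakDeriv_weakDeriv ⟨g, hu⟩).ae_eq hΩ hu (EventuallyEq.refl _ _)

theorem isWeakDeriv_of_contDiff [(volume : Measure E).IsAddHaarMeasure] (hφ : ContDiff ℝ ∞ φ) :
    IsWeakDeriv Ω e φ (fun x => fderiv ℝ φ x e) := by
  have hφ' := continuous_fderiv_apply_const hφ e
  refine ⟨hφ.continuous.locallyIntegrable.locallyIntegrableOn _,
    hφ'.locallyIntegrable.locallyIntegrableOn _, fun η hη hc hs => ?_⟩
  have hη' := continuous_fderiv_apply_const hη e
  rw [setIntegral_mul_eq_integral_of_tsupport_subset _ hs,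
    setIntegral_mul_eq_integral_of_tsupport_subset _ ((tsupport_fderiv_apply_subset ℝ e).trans hs)]
  exact integral_mul_fderiv_eq_neg_fderiv_mul_of_integrable
    ((hφ'.mul hη.continuous).integrable_of_hasCompactSupport hc.mul_left)
    ((hφ.continuous.mul hη').integrable_of_hasCompactSupport (hc.fderiv_apply ℝ e).mul_left)
    ((hφ.continuous.mul hη.continuous).integrable_of_hasCompactSupport hc.mul_left)
    (fun x _ => hφ.differentiable (by simp) x) (fun x _ => hη.differentiable (by simp) x)

theorem weakDeriv_sub_ae_eq (hΩ : IsOpen Ω) (hu : WeaklyDifferentiable Ω e u)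
    (hv : WeaklyDifferentiable Ω e v) :
    weakDeriv Ω e (u - v) =ᵐ[volume.restrict Ω] weakDeriv Ω e u - weakDeriv Ω e v :=
  (hu.isWeakDeriv_weakDeriv.sub hv.isWeakDeriv_weakDeriv).weakDeriv_ae_eq hΩ

end WeakDerivative

section Product

variable {α β : Type*} [MeasurableSpace α] [MeasurableSpace β] {μ : Measure α} {ν : Measure β}
  [SFinite μ] [SFinite ν]

theorem integrable_and_integral_le_of_slices {F G : α × β → ℝ} {K : ℝ}
    (hF : AEStronglyMeasurable F (μ.prod ν)) (hF0 : 0 ≤ᵐ[μ.prod ν] F)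
    (hG : Integrable G (μ.prod ν))
    (hslice : ∀ᵐ x ∂μ, Integrable (fun y => F (x, y)) ν ∧
      ∫ y, F (x, y) ∂ν ≤ K * ∫ y, G (x, y) ∂ν) :
    Integrable F (μ.prod ν) ∧ ∫ p, F p ∂μ.prod ν ≤ K * ∫ p, G p ∂μ.prod ν := by
  have hGint := hG.integral_prod_left.const_mul K
  have hFint : Integrable F (μ.prod ν) := by
    refine (integrable_prod_iff hF).2 ⟨hslice.mono fun x hx => hx.1, ?_⟩
    refine hGint.mono' hF.norm.integral_prod_right' ?_
    filter_upwards [hslice, Measure.ae_ae_of_ae_prod hF0] with x hx hx0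
    rw [Real.norm_of_nonneg (integral_nonneg fun _ => norm_nonneg _)]
    exact (integral_congr_ae (hx0.mono fun y hy => Real.norm_of_nonneg hy)).trans_le hx.2
  refine ⟨hFint, ?_⟩
  rw [integral_prod _ hFint, integral_prod _ hG, ← integral_const_mul]
  exact integral_mono_ae hFint.integral_prod_left hGint (hslice.mono fun x hx => hx.2)

end Product

section Rectangle

variable {Θ : ℝ} {ρ : ℝ → ℝ} {v g : ℝ × ℝ → ℝ}

theorem isOpen_Q (Θ : ℝ) : IsOpen (Q Θ) :=
  isOpen_Ioo.prod isOpen_Ioo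

theorem volume_restrict_Q (Θ : ℝ) : (volume.restrict (Q Θ) : Measure (ℝ × ℝ)) =
    (volume.restrict (Ioo (0 : ℝ) 1)).prod (volume.restrict (Ioc 0 Θ)) := by
  rw [← Measure.restrict_congr_set Ioo_ae_eq_Ioc, Measure.prod_restrict]
  rfl

theorem ae_ae_of_ae_Q {P : ℝ × ℝ → Prop} (h : ∀ᵐ p ∂volume.restrict (Q Θ), P p) :
    ∀ᵐ r ∂volume.restrict (Ioo (0 : ℝ) 1), ∀ᵐ θ ∂volume.restrict (Ioc 0 Θ), P (r, θ) := by
  rw [volume_restrict_Q] at h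
  exact Measure.ae_ae_of_ae_prod h

theorem isWeight_radius : IsWeight (Ioo 0 1) fun r : ℝ => r :=
  ⟨isOpen_Ioo, continuousOn_id, fun _ hr => hr.1⟩

theorem IsWeight.comp_fst (hρ : IsWeight (Ioo 0 1) ρ) (Θ : ℝ) :
    IsWeight (Q Θ) fun p => ρ p.1 :=
  ⟨isOpen_Q Θ, hρ.continuousOn.comp continuousOn_fst fun _ hp => hp.1, fun _ hp => hρ.pos _ hp.1⟩

theorem isWeight_wr (Θ : ℝ) : IsWeight (Q Θ) wr :=
  isWeight_radius.comp_fst Θ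

theorem isWeight_one_div_radius : IsWeight (Ioo 0 1) fun r : ℝ => 1 / r := by
  simp only [one_div]
  exact isWeight_radius.inv

theorem isWeight_wrInv (Θ : ℝ) : IsWeight (Q Θ) wrInv :=
  isWeight_one_div_radius.comp_fst Θ

theorem wr_le_wrInv {p : ℝ × ℝ} (hp : p ∈ Q Θ) : wr p ≤ wrInv p :=
  hp.1.2.le.trans ((one_le_div hp.1.1).2 hp.1.2.le)

theorem MemL2.wr_of_wrInv (hv : MemL2 (Q Θ) wrInv v) : MemL2 (Q Θ) wr v :=
  hv.mono_weight (isWeight_wr Θ) fun _ => wr_le_wrInv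

theorem MemL2.ae_memLp_slice (hv : MemL2 (Q Θ) wr v) :
    ∀ᵐ r ∂volume.restrict (Ioo (0 : ℝ) 1),
      MemLp (fun θ => v (r, θ)) 2 (volume.restrict (Ioc 0 Θ)) := by
  obtain ⟨hmeas, hint⟩ := hv
  rw [IntegrableOn] at hint
  rw [volume_restrict_Q] at hmeas hint
  filter_upwards [hint.prod_right_ae, hmeas.prodMk_left, ae_restrict_mem measurableSet_Ioo]
    with r hint_r hmeas_r hr
  refine (memLp_two_iff_integrable_sq hmeas_r).2 ((hint_r.mul_const r⁻¹).congr ?_)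
  exact ae_of_all _ fun θ => mul_inv_cancel_right₀ hr.1.ne' _

theorem memL2_and_normL2_le_of_slices (hρ : IsWeight (Ioo 0 1) ρ)
    (hv : AEStronglyMeasurable v (volume.restrict (Q Θ))) (hg : MemL2 (Q Θ) (fun p => ρ p.1) g)
    {C : ℝ} (hC : 0 ≤ C)
    (hslice : ∀ᵐ r ∂volume.restrict (Ioo (0 : ℝ) 1),
      MemLp (fun θ => v (r, θ)) 2 (volume.restrict (Ioc 0 Θ)) ∧
      ∫ θ in Ioc 0 Θ, v (r, θ) ^ 2 ≤ C ^ 2 * ∫ θ in Ioc 0 Θ, g (r, θ) ^ 2) :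
    MemL2 (Q Θ) (fun p => ρ p.1) v ∧
      normL2 (Q Θ) (fun p => ρ p.1) v ≤ C * normL2 (Q Θ) (fun p => ρ p.1) g := by
  have hw := hρ.comp_fst Θ
  have hF : AEStronglyMeasurable (fun p => v p ^ 2 * ρ p.1) (volume.restrict (Q Θ)) :=
    (hv.pow 2).mul hw.aestronglyMeasurable
  have hF0 : 0 ≤ᵐ[volume.restrict (Q Θ)] fun p => v p ^ 2 * ρ p.1 := by
    filter_upwards [ae_restrict_mem hw.measurableSet] with p hp
    exact mul_nonneg (sq_nonneg _) (hw.pos p hp).le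
  have hG := hg.2
  rw [IntegrableOn] at hG
  rw [volume_restrict_Q] at hF hF0 hG
  have key := integrable_and_integral_le_of_slices (K := C ^ 2) hF hF0 hG (by
    filter_upwards [hslice, ae_restrict_mem measurableSet_Ioo] with r hr hr0
    refine ⟨hr.1.integrable_sq.mul_const _, ?_⟩
    simp only [integral_mul_const, ← mul_assoc]
    exact mul_le_mul_of_nonneg_right hr.2 (hρ.pos r hr0).le)
  rw [← volume_restrict_Q] at key
  refine ⟨⟨hv, key.1⟩, abs_le_of_sq_le_sq' ?_ (mul_nonneg hC normL2_nonneg) |>.2⟩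
  rw [mul_pow, hw.normL2_sq, hw.normL2_sq]
  exact key.2

end Rectangle

section Primitive

variable {f : ℝ → ℝ} {α β ϑ : ℝ}

theorem intervalIntegrable_of_memLp (hf : MemLp f 2 (volume.restrict (Ioc α β))) {a b : ℝ}
    (ha : a ∈ Icc α β) (hb : b ∈ Icc α β) : IntervalIntegrable f volume a b := by
  have hαβ : α ≤ β := ha.1.trans ha.2
  have h : IntervalIntegrable f volume α β :=
    (intervalIntegrable_iff_integrableOn_Ioc_of_le hαβ).2 (hf.integrable one_le_two)
  refine h.mono_set ?_
  rw [uIcc_of_le hαβ]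
  exact uIcc_subset_Icc ha hb

theorem sq_intervalIntegral_le (hf : MemLp f 2 (volume.restrict (Ioc α β))) {a b : ℝ}
    (ha : a ∈ Icc α β) (hb : b ∈ Icc α β) :
    (∫ t in a..b, f t) ^ 2 ≤ (β - α) * ∫ t in Ioc α β, f t ^ 2 := by
  wlog hab : a ≤ b generalizing a b
  · rw [intervalIntegral.integral_symm, neg_sq]
    exact this hb ha (le_of_not_ge hab)
  have hsub : Ioc a b ⊆ Ioc α β := Ioc_subset_Ioc ha.1 hb.2
  rw [intervalIntegral.integral_of_le hab]
  calc (∫ t in Ioc a b, f t) ^ 2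
      ≤ (b - a) * ∫ t in Ioc a b, f t ^ 2 := by
        simpa [Real.volume_real_Ioc_of_le hab] using
          sq_integral_le_measureReal_mul (hf.mono_measure (Measure.restrict_mono_set _ hsub))
    _ ≤ (β - α) * ∫ t in Ioc α β, f t ^ 2 := by
        gcongr
        · exact sub_nonneg.2 (ha.1.trans ha.2)
        · exact hb.2
        · exact ha.1
        · exact ae_of_all _ fun _ => sq_nonneg _
        · exact hf.integrable_sq

theorem memLp_primitive (hf : MemLp f 2 (volume.restrict (Ioc α β))) (hϑ : ϑ ∈ Icc α β) :
    MemLp (fun θ => ∫ t in ϑ..θ, f t) 2 (volume.restrict (Ioc α β)) := by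
  have hαβ : α ≤ β := hϑ.1.trans hϑ.2
  have hcont : ContinuousOn (fun θ => ∫ t in ϑ..θ, f t) (Icc α β) := by
    rw [← uIcc_of_le hαβ] at hϑ ⊢
    exact intervalIntegral.continuousOn_primitive_interval'
      (intervalIntegrable_of_memLp hf (left_mem_Icc.2 hαβ) (right_mem_Icc.2 hαβ)) hϑ
  refine (memLp_two_iff_integrable_sq ?_).2 ?_
  · exact (hcont.mono Ioc_subset_Icc_self).aestronglyMeasurable measurableSet_Ioc
  · exact ((hcont.pow 2).integrableOn_compact isCompact_Icc).mono_set Ioc_subset_Icc_self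

theorem integral_sq_primitive_le (hf : MemLp f 2 (volume.restrict (Ioc α β)))
    (hϑ : ϑ ∈ Icc α β) :
    ∫ θ in Ioc α β, (∫ t in ϑ..θ, f t) ^ 2 ≤ (β - α) ^ 2 * ∫ t in Ioc α β, f t ^ 2 := by
  have hαβ : α ≤ β := hϑ.1.trans hϑ.2
  calc ∫ θ in Ioc α β, (∫ t in ϑ..θ, f t) ^ 2
      ≤ ∫ θ in Ioc α β, (β - α) * ∫ t in Ioc α β, f t ^ 2 :=
        setIntegral_mono_on (memLp_primitive hf hϑ).integrable_sq
          (integrableOn_const measure_Ioc_lt_top.ne) measurableSet_Ioc fun θ hθ =>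
            sq_intervalIntegral_le hf hϑ (Ioc_subset_Icc_self hθ)
    _ = (β - α) ^ 2 * ∫ t in Ioc α β, f t ^ 2 := by
        rw [setIntegral_const, Real.volume_real_Ioc_of_le hαβ, smul_eq_mul, ← mul_assoc, sq]

end Primitive

section AngularPrimitive

variable {Θ ϑ : ℝ} {g g' : ℝ × ℝ → ℝ}

/-- The primitive in the angular variable of `g` that vanishes at the angle `ϑ`. -/
noncomputable def angularPrimitive (ϑ : ℝ) (g : ℝ × ℝ → ℝ) (p : ℝ × ℝ) : ℝ :=
  ∫ t in ϑ..p.2, g (p.1, t)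

theorem stronglyMeasurable_angularPrimitive (hg : StronglyMeasurable g) (ϑ : ℝ) :
    StronglyMeasurable (angularPrimitive ϑ g) := by
  have setIntegral (S : Set ((ℝ × ℝ) × ℝ)) (hS : MeasurableSet S) :
      StronglyMeasurable fun p : ℝ × ℝ => ∫ t in Prod.mk p ⁻¹' S, g (p.1, t) := by
    have hind : StronglyMeasurable (S.indicator fun q => g (q.1.1, q.2)) :=
      (hg.comp_measurable (by fun_prop)).indicator hS
    convert hind.integral_prod_right' (ν := volume) using 2 with p
    exact (integral_indicator (measurable_prodMk_left hS)).symm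
  exact (setIntegral {q | q.2 ∈ Ioc ϑ q.1.2} (by measurability)).sub
    (setIntegral {q | q.2 ∈ Ioc q.1.2 ϑ} (by measurability))

theorem angularPrimitive_congr (h : g =ᵐ[volume.restrict (Q Θ)] g') (hϑ : ϑ ∈ Icc 0 Θ) :
    angularPrimitive ϑ g =ᵐ[volume.restrict (Q Θ)] angularPrimitive ϑ g' := by
  have hslice : ∀ᵐ p ∂volume.restrict (Q Θ),
      ∀ᵐ t ∂volume.restrict (Ioc 0 Θ), g (p.1, t) = g' (p.1, t) := by
    rw [volume_restrict_Q]
    exact Measure.quasiMeasurePreserving_fst.ae (ae_ae_of_ae_Q h)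
  filter_upwards [hslice, ae_restrict_mem (isOpen_Q Θ).measurableSet] with p hp hpQ
  refine intervalIntegral.integral_congr_ae_restrict (ae_restrict_of_ae_restrict_of_subset ?_ hp)
  exact Ioc_subset_Ioc (le_min hϑ.1 hpQ.2.1.le) (max_le hϑ.2 hpQ.2.2.le)

theorem aestronglyMeasurable_angularPrimitive (hϑ : ϑ ∈ Icc 0 Θ)
    (hg : AEStronglyMeasurable g (volume.restrict (Q Θ))) :
    AEStronglyMeasurable (angularPrimitive ϑ g) (volume.restrict (Q Θ)) :=
  ⟨_, stronglyMeasurable_angularPrimitive hg.stronglyMeasurable_mk ϑ,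
    angularPrimitive_congr hg.ae_eq_mk hϑ⟩

theorem memL2_and_normL2_angularPrimitive_le (hϑ : ϑ ∈ Icc 0 Θ) (hg : MemL2 (Q Θ) wr g) :
    MemL2 (Q Θ) wr (angularPrimitive ϑ g) ∧
      normL2 (Q Θ) wr (angularPrimitive ϑ g) ≤ Θ * normL2 (Q Θ) wr g := by
  refine memL2_and_normL2_le_of_slices isWeight_radius
    (aestronglyMeasurable_angularPrimitive hϑ hg.1) hg (hϑ.1.trans hϑ.2) ?_
  filter_upwards [hg.ae_memLp_slice] with r hr
  exact ⟨memLp_primitive hr hϑ, (integral_sq_primitive_le hr hϑ).trans_eq (by rw [sub_zero])⟩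

end AngularPrimitive

section RadialFunction

variable {Θ : ℝ} {ρ τ : ℝ → ℝ}

theorem ae_Q_of_ae_radius {P : ℝ → Prop} (h : ∀ᵐ r ∂volume.restrict (Ioo (0 : ℝ) 1), P r) (Θ : ℝ) :
    ∀ᵐ p ∂volume.restrict (Q Θ), P p.1 := by
  rw [volume_restrict_Q]
  exact Measure.quasiMeasurePreserving_fst.ae h

theorem memL2_comp_fst_iff (hΘ : 0 < Θ) :
    MemL2 (Q Θ) (fun p => ρ p.1) (fun p => τ p.1) ↔ MemL2 (Ioo 0 1) ρ τ := by
  have hne : volume.restrict (Ioc 0 Θ) ≠ 0 := by simp [hΘ]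
  rw [MemL2, MemL2, IntegrableOn, volume_restrict_Q, AEStronglyMeasurable.comp_fst_iff hne]
  exact and_congr_right' (Integrable.comp_fst_iff (f := fun r => τ r ^ 2 * ρ r) hne)

theorem normL2_comp_fst (hΘ : 0 ≤ Θ) :
    normL2 (Q Θ) (fun p => ρ p.1) (fun p => τ p.1) = √Θ * normL2 (Ioo 0 1) ρ τ := by
  rw [normL2, normL2, ← Real.sqrt_mul hΘ, volume_restrict_Q,
    integral_fun_fst fun r => τ r ^ 2 * ρ r]
  simp [Real.volume_real_Ioc_of_le hΘ]

end RadialFunction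

section AngularTrace

variable {Θ ϑ ϑ' : ℝ} {v v' g g' φ : ℝ × ℝ → ℝ} {τ τ' : ℝ → ℝ}

/-- `v` is absolutely continuous in the angular variable, with angular derivative `g` and with
value `τ` at the angle `ϑ`. The value at a single angle makes sense because it is read off from
the primitive of `g`, not from the representative `v`. -/
def IsAngularTrace (Θ ϑ : ℝ) (v g : ℝ × ℝ → ℝ) (τ : ℝ → ℝ) : Prop :=
  v =ᵐ[volume.restrict (Q Θ)] fun p => τ p.1 + angularPrimitive ϑ g p

namespace IsAngularTrace

theorem congr (h : IsAngularTrace Θ ϑ v g τ) (hϑ : ϑ ∈ Icc 0 Θ)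
    (hg : g =ᵐ[volume.restrict (Q Θ)] g') (hτ : τ =ᵐ[volume.restrict (Ioo 0 1)] τ') :
    IsAngularTrace Θ ϑ v g' τ' := by
  filter_upwards [h, angularPrimitive_congr hg hϑ, ae_Q_of_ae_radius hτ Θ] with p hp hgp hτp
  rw [hp, hgp, hτp]

theorem sub (h : IsAngularTrace Θ ϑ v g τ) (h' : IsAngularTrace Θ ϑ v' g' τ')
    (hϑ : ϑ ∈ Icc 0 Θ) (hg : MemL2 (Q Θ) wr g) (hg' : MemL2 (Q Θ) wr g') :
    IsAngularTrace Θ ϑ (v - v') (g - g') (τ - τ') := by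
  filter_upwards [h, h', ae_Q_of_ae_radius hg.ae_memLp_slice Θ,
    ae_Q_of_ae_radius hg'.ae_memLp_slice Θ, ae_restrict_mem (isOpen_Q Θ).measurableSet]
    with p hp hp' hgp hgp' hpQ
  have hθ : p.2 ∈ Icc 0 Θ := Ioo_subset_Icc_self hpQ.2
  simp only [Pi.sub_apply, angularPrimitive, hp, hp', intervalIntegral.integral_sub
    (intervalIntegrable_of_memLp hgp hϑ hθ) (intervalIntegrable_of_memLp hgp' hϑ hθ)]
  ring

theorem change_base (h : IsAngularTrace Θ ϑ v g τ) (hϑ : ϑ ∈ Icc 0 Θ) (hϑ' : ϑ' ∈ Icc 0 Θ)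
    (hg : MemL2 (Q Θ) wr g) :
    IsAngularTrace Θ ϑ' v g fun r => τ r + angularPrimitive ϑ g (r, ϑ') := by
  filter_upwards [h, ae_Q_of_ae_radius hg.ae_memLp_slice Θ,
    ae_restrict_mem (isOpen_Q Θ).measurableSet] with p hp hgp hpQ
  have hθ : p.2 ∈ Icc 0 Θ := Ioo_subset_Icc_self hpQ.2
  simp only [hp, angularPrimitive, add_assoc, intervalIntegral.integral_add_adjacent_intervals
    (intervalIntegrable_of_memLp hgp hϑ hϑ') (intervalIntegrable_of_memLp hgp hϑ' hθ)]

theorem comp_fst_ae_eq (h : IsAngularTrace Θ ϑ v g τ) :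
    v - angularPrimitive ϑ g =ᵐ[volume.restrict (Q Θ)] fun p => τ p.1 :=
  h.mono fun p hp => by rw [Pi.sub_apply, hp, add_sub_cancel_right]

theorem memL2 (h : IsAngularTrace Θ ϑ v g τ) (hΘ : 0 < Θ) (hϑ : ϑ ∈ Icc 0 Θ)
    (hv : MemL2 (Q Θ) wr v) (hg : MemL2 (Q Θ) wr g) : MemL2 (Ioo 0 1) (fun r => r) τ :=
  (memL2_comp_fst_iff hΘ).1 <|
    (hv.sub (isWeight_wr Θ) (memL2_and_normL2_angularPrimitive_le hϑ hg).1).congr h.comp_fst_ae_eq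

theorem sqrt_mul_normL2_le (h : IsAngularTrace Θ ϑ v g τ) (hϑ : ϑ ∈ Icc 0 Θ)
    (hv : MemL2 (Q Θ) wr v) (hg : MemL2 (Q Θ) wr g) :
    √Θ * normL2 (Ioo 0 1) (fun r => r) τ ≤ normL2 (Q Θ) wr v + Θ * normL2 (Q Θ) wr g := by
  obtain ⟨hprim, hle⟩ := memL2_and_normL2_angularPrimitive_le hϑ hg
  calc √Θ * normL2 (Ioo 0 1) (fun r => r) τ
      = normL2 (Q Θ) wr fun p => τ p.1 := (normL2_comp_fst (hϑ.1.trans hϑ.2)).symm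
    _ = normL2 (Q Θ) wr (v - angularPrimitive ϑ g) := (normL2_congr h.comp_fst_ae_eq).symm
    _ ≤ normL2 (Q Θ) wr v + Θ * normL2 (Q Θ) wr g :=
        (normL2_sub_le (isWeight_wr Θ) hv hprim).trans (by gcongr)

end IsAngularTrace

theorem hasDerivAt_angular (hφ : ContDiff ℝ ∞ φ) (r θ : ℝ) :
    HasDerivAt (fun t => φ (r, t)) (fderiv ℝ φ (r, θ) dirTheta) θ :=
  HasFDerivAt.comp_hasDerivAt θ (hφ.differentiable (by simp) (r, θ)).hasFDerivAt
    ((hasDerivAt_const θ r).prodMk (hasDerivAt_id θ))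

theorem isAngularTrace_of_contDiff (hφ : ContDiff ℝ ∞ φ) (Θ ϑ : ℝ) :
    IsAngularTrace Θ ϑ φ (fun p => fderiv ℝ φ p dirTheta) fun r => φ (r, ϑ) :=
  ae_of_all _ fun p => by
    have hcont : Continuous fun θ => fderiv ℝ φ (p.1, θ) dirTheta :=
      (continuous_fderiv_apply_const hφ _).comp (by fun_prop)
    have ftc : angularPrimitive ϑ (fun q => fderiv ℝ φ q dirTheta) p = φ p - φ (p.1, ϑ) :=
      intervalIntegral.integral_eq_sub_of_hasDerivAt
        (fun θ _ => hasDerivAt_angular hφ p.1 θ) (hcont.intervalIntegrable _ _)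
    simp only [ftc, add_sub_cancel]

theorem integral_primitive_mul_deriv {f ψ ψ' : ℝ → ℝ} {a b k : ℝ}
    (hf : IntervalIntegrable f volume a b) (hψ : ∀ x, HasDerivAt ψ (ψ' x) x)
    (hψ' : Continuous ψ') (ha : ψ a = 0) (hb : ψ b = 0) :
    ∫ x in a..b, (k + ∫ t in a..x, f t) * ψ' x = -∫ x in a..b, f x * ψ x := by
  obtain rfl : deriv ψ = ψ' := funext fun x => (hψ x).deriv
  have hψ1 : ContDiff ℝ 1 ψ := contDiff_one_iff_deriv.2 ⟨fun x => (hψ x).differentiableAt, hψ'⟩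
  have hprim : AbsolutelyContinuousOnInterval (fun x => k + ∫ t in a..x, f t) a b :=
    (contDiffOn_const (c := k)).absolutelyContinuousOnInterval.add
      (hf.absolutelyContinuousOnInterval_intervalIntegral left_mem_uIcc)
  rw [hprim.integral_mul_deriv_eq_deriv_mul hψ1.contDiffOn.absolutelyContinuousOnInterval, ha, hb,
    mul_zero, mul_zero, sub_zero, zero_sub]
  congr 1
  refine intervalIntegral.integral_congr_ae ?_
  filter_upwards [hf.ae_hasDerivAt_integral] with x hx hxab
  rw [((hx (uIoc_subset_uIcc hxab) a left_mem_uIcc).const_add k).deriv]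

theorem IsAngularTrace.isWeakDeriv (h : IsAngularTrace Θ 0 v g τ) (hΘ : 0 ≤ Θ)
    (hv : MemL2 (Q Θ) wr v) (hg : MemL2 (Q Θ) wr g) : IsWeakDeriv (Q Θ) dirTheta v g := by
  have hvloc := hv.locallyIntegrableOn (isWeight_wr Θ)
  have hgloc := hg.locallyIntegrableOn (isWeight_wr Θ)
  refine ⟨hvloc, hgloc, fun φ hφ hc hs => ?_⟩
  have hleft : IntegrableOn (fun p => v p * fderiv ℝ φ p dirTheta) (Q Θ) :=
    (integrable_mul_of_tsupport_subset hvloc (continuous_fderiv_apply_const hφ _)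
      (hc.fderiv_apply ℝ _) ((tsupport_fderiv_apply_subset ℝ _).trans hs)).integrableOn
  have hright : IntegrableOn (fun p => g p * φ p) (Q Θ) :=
    (integrable_mul_of_tsupport_subset hgloc hφ.continuous hc hs).integrableOn
  rw [IntegrableOn, volume_restrict_Q] at hleft hright
  rw [volume_restrict_Q, integral_prod _ hleft, integral_prod _ hright, ← integral_neg]
  refine integral_congr_ae ?_
  filter_upwards [ae_ae_of_ae_Q h, hg.ae_memLp_slice] with r hr hgr
  have hvanish : ∀ θ ∉ Ioo 0 Θ, φ (r, θ) = 0 := fun θ hθ =>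
    image_eq_zero_of_notMem_tsupport fun hmem => hθ (hs hmem).2
  have hcont : Continuous fun θ => fderiv ℝ φ (r, θ) dirTheta :=
    (continuous_fderiv_apply_const hφ _).comp (by fun_prop)
  have parts := integral_primitive_mul_deriv (k := τ r)
    (intervalIntegrable_of_memLp hgr (left_mem_Icc.2 hΘ) (right_mem_Icc.2 hΘ))
    (hasDerivAt_angular hφ r) hcont
    (hvanish 0 (by simp)) (hvanish Θ (by simp))
  rw [intervalIntegral.integral_of_le hΘ, intervalIntegral.integral_of_le hΘ] at parts
  exact (integral_congr_ae (hr.mono fun θ hθ => by simp only [hθ, angularPrimitive])).trans parts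

end AngularTrace

section AngularTestFunction

variable {Θ : ℝ} {ζ φ : ℝ × ℝ → ℝ} {η : ℝ → ℝ}

open scoped Convolution in
theorem contDiff_integral_comp_sub (hζ : ContDiff ℝ ∞ ζ) (hc : HasCompactSupport ζ)
    (ν : Measure ℝ) [IsLocallyFiniteMeasure ν] :
    ContDiff ℝ ∞ fun p : ℝ × ℝ => ∫ t, ζ (p.1, p.2 - t) ∂ν := by
  -- The integral is the convolution of `1` with `ζ` for the measure `δ₀ ⊗ ν`.
  convert hc.contDiff_convolution_right (n := ⊤) (ContinuousLinearMap.mul ℝ ℝ)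
    (μ := (Measure.dirac (0 : ℝ)).prod ν) (locallyIntegrable_const (1 : ℝ)) hζ using 1
  ext p
  have hcont : Continuous fun q => ζ (p - q) := hζ.continuous.comp (by fun_prop)
  simp only [convolution_def, ContinuousLinearMap.mul_apply', one_mul, Measure.dirac_prod]
  rw [integral_map (by fun_prop) hcont.aestronglyMeasurable]
  simp only [Prod.sub_def, sub_zero]

theorem contDiff_integral_fiber (hφ : ContDiff ℝ ∞ φ) (hc : HasCompactSupport φ) :
    ContDiff ℝ ∞ fun r : ℝ => ∫ s, φ (r, s) := by
  have h := (contDiff_integral_comp_sub hφ hc volume).comp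
    (contDiff_id.prodMk (contDiff_const (c := (0 : ℝ))))
  convert h using 2 with r
  exact (integral_sub_left_eq_self (fun s => φ (r, s)) volume 0).symm

theorem contDiff_integral_Iic (hζ : ContDiff ℝ ∞ ζ) (hc : HasCompactSupport ζ) :
    ContDiff ℝ ∞ fun p : ℝ × ℝ => ∫ s in Iic p.2, ζ (p.1, s) := by
  convert contDiff_integral_comp_sub hζ hc (volume.restrict (Ici 0)) using 2 with p
  have hpre : (fun t => p.2 - t) ⁻¹' Iic p.2 = Ici 0 := by ext t; simp
  rw [← hpre]
  exact ((Measure.measurePreserving_sub_left volume p.2).setIntegral_preimage_emb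
    (MeasurableEquiv.subLeft p.2).measurableEmbedding (fun s => ζ (p.1, s)) (Iic p.2)).symm

theorem hasCompactSupport_fiber (hc : HasCompactSupport ζ) (r : ℝ) :
    HasCompactSupport fun s => ζ (r, s) :=
  .intro (hc.isCompact.image continuous_snd) fun s hs =>
    image_eq_zero_of_notMem_tsupport (f := ζ) fun hmem => hs ⟨(r, s), hmem, rfl⟩

theorem integrable_fiber (hζ : Continuous ζ) (hc : HasCompactSupport ζ) (r : ℝ) :
    Integrable fun s => ζ (r, s) :=
  Continuous.integrable_of_hasCompactSupport (by fun_prop) (hasCompactSupport_fiber hc r)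

theorem fderiv_integral_Iic_dirTheta (hζ : ContDiff ℝ ∞ ζ) (hc : HasCompactSupport ζ)
    (p : ℝ × ℝ) :
    fderiv ℝ (fun p : ℝ × ℝ => ∫ s in Iic p.2, ζ (p.1, s)) p dirTheta = ζ p := by
  have hint (t : ℝ) : IntegrableOn (fun s => ζ (p.1, s)) (Iic t) :=
    (integrable_fiber hζ.continuous hc p.1).integrableOn
  have hftc : HasDerivAt (fun θ => ∫ s in Iic θ, ζ (p.1, s)) (ζ p) p.2 := by
    have hcont : Continuous fun s => ζ (p.1, s) := hζ.continuous.comp (by fun_prop)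
    have hprim := (hcont.integral_hasStrictDerivAt 0 p.2).hasDerivAt.add_const
      (∫ s in Iic 0, ζ (p.1, s))
    simpa only [← intervalIntegral.integral_Iic_sub_Iic (hint _) (hint _),
      sub_add_cancel] using hprim
  exact (hasDerivAt_angular (contDiff_integral_Iic hζ hc) p.1 p.2).unique hftc

theorem tsupport_integral_Iic_subset (hζ : Continuous ζ) (hc : HasCompactSupport ζ)
    (hfiber : ∀ r, ∫ s, ζ (r, s) = 0) :
    tsupport (fun p : ℝ × ℝ => ∫ s in Iic p.2, ζ (p.1, s)) ⊆
      (Prod.fst '' tsupport ζ) ×ˢ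
        Icc (sInf (Prod.snd '' tsupport ζ)) (sSup (Prod.snd '' tsupport ζ)) := by
  have hS := hc.isCompact.image continuous_snd
  refine closure_minimal (fun p hp => ?_)
    ((hc.isCompact.image continuous_fst).isClosed.prod isClosed_Icc)
  have exists_mem {S : Set ℝ} (hS : ∫ s in S, ζ (p.1, s) ≠ 0) :
      ∃ s ∈ S, (p.1, s) ∈ tsupport ζ := by
    contrapose! hS
    exact setIntegral_eq_zero_of_forall_eq_zero fun s hs =>
      image_eq_zero_of_notMem_tsupport (hS s hs)
  have hIoi : ∫ s in Ioi p.2, ζ (p.1, s) ≠ 0 := fun h => hp <| by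
    have hint := integrable_fiber hζ hc p.1
    have := intervalIntegral.integral_Iic_add_Ioi (b := p.2) hint.integrableOn hint.integrableOn
    rwa [h, add_zero, hfiber] at this
  obtain ⟨a, ha, hamem⟩ := exists_mem hp
  obtain ⟨b, hb, hbmem⟩ := exists_mem hIoi
  exact ⟨⟨_, hamem, rfl⟩, (csInf_le hS.bddBelow ⟨_, hamem, rfl⟩).trans ha,
    (le_of_lt hb).trans (le_csSup hS.bddAbove ⟨_, hbmem, rfl⟩)⟩

theorem IsWeakDeriv.integral_mul_eq_zero {f : ℝ × ℝ → ℝ}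
    (hf : IsWeakDeriv (Q Θ) dirTheta f 0) (hζ : ContDiff ℝ ∞ ζ) (hc : HasCompactSupport ζ)
    (hs : tsupport ζ ⊆ Q Θ) (hfiber : ∀ r, ∫ s, ζ (r, s) = 0) :
    ∫ p in Q Θ, f p * ζ p = 0 := by
  have hsub := tsupport_integral_Iic_subset hζ.continuous hc hfiber
  have hS := hc.isCompact.image continuous_snd
  have hSΘ : Prod.snd '' tsupport ζ ⊆ Ioo 0 Θ := image_subset_iff.2 fun p hp => (hs hp).2
  have hcompact := (hc.isCompact.image continuous_fst).prod
    (isCompact_Icc (a := sInf (Prod.snd '' tsupport ζ)) (b := sSup (Prod.snd '' tsupport ζ)))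
  have hQ : (Prod.fst '' tsupport ζ) ×ˢ
      Icc (sInf (Prod.snd '' tsupport ζ)) (sSup (Prod.snd '' tsupport ζ)) ⊆ Q Θ := by
    rintro p ⟨⟨q, hq, hqp⟩, hp⟩
    have hne : (Prod.snd '' tsupport ζ).Nonempty := ⟨_, q, hq, rfl⟩
    exact ⟨hqp ▸ (hs hq).1, (hSΘ (hS.sInf_mem hne)).1.trans_le hp.1,
      hp.2.trans_lt (hSΘ (hS.sSup_mem hne)).2⟩
  have h := hf.2.2 _ (contDiff_integral_Iic hζ hc)
    (hcompact.of_isClosed_subset (isClosed_tsupport _) hsub) (hsub.trans hQ)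
  simpa only [fderiv_integral_Iic_dirTheta hζ hc, Pi.zero_apply, zero_mul, integral_zero,
    neg_zero] using h

/-- The test function `φ` minus a multiple of the angular profile `η` on each fiber `r = const`.
For `∫ η = 1` all its fiber integrals vanish, so that it is the angular derivative of a test
function. -/
noncomputable def fiberBalanced (η : ℝ → ℝ) (φ : ℝ × ℝ → ℝ) (p : ℝ × ℝ) : ℝ :=
  φ p - η p.2 * ∫ s, φ (p.1, s)

theorem contDiff_fiberBalanced (hη : ContDiff ℝ ∞ η) (hφ : ContDiff ℝ ∞ φ)
    (hc : HasCompactSupport φ) : ContDiff ℝ ∞ (fiberBalanced η φ) :=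
  hφ.sub ((hη.comp contDiff_snd).mul ((contDiff_integral_fiber hφ hc).comp contDiff_fst))

theorem integral_fiberBalanced (hη : Integrable η) (hη1 : ∫ s, η s = 1) (hφ : Continuous φ)
    (hc : HasCompactSupport φ) (r : ℝ) : ∫ s, fiberBalanced η φ (r, s) = 0 := by
  simp only [fiberBalanced]
  rw [integral_sub (integrable_fiber hφ hc r) (hη.mul_const _), integral_mul_const, hη1, one_mul,
    sub_self]

theorem tsupport_fiberBalanced_subset (hη : HasCompactSupport η) (hc : HasCompactSupport φ) :
    tsupport (fiberBalanced η φ) ⊆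
      (Prod.fst '' tsupport φ) ×ˢ (Prod.snd '' tsupport φ ∪ tsupport η) := by
  have hclosed : IsClosed ((Prod.fst '' tsupport φ) ×ˢ (Prod.snd '' tsupport φ ∪ tsupport η)) :=
    ((hc.isCompact.image continuous_fst).prod
      ((hc.isCompact.image continuous_snd).union hη.isCompact)).isClosed
  refine closure_minimal (fun p hp => ?_) hclosed
  contrapose! hp
  have hφp : φ p = 0 := image_eq_zero_of_notMem_tsupport fun hmem =>
    hp ⟨⟨p, hmem, rfl⟩, .inl ⟨p, hmem, rfl⟩⟩
  simp only [Function.mem_support, not_not, fiberBalanced, hφp, zero_sub, neg_eq_zero, mul_eq_zero]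
  by_cases hr : p.1 ∈ Prod.fst '' tsupport φ
  · exact .inl (image_eq_zero_of_notMem_tsupport fun hmem => hp ⟨hr, .inr hmem⟩)
  · refine .inr (integral_eq_zero_of_ae (ae_of_all _ fun s => ?_))
    exact image_eq_zero_of_notMem_tsupport fun hmem => hr ⟨_, hmem, rfl⟩

theorem hasCompactSupport_fiberBalanced (hη : HasCompactSupport η) (hc : HasCompactSupport φ) :
    HasCompactSupport (fiberBalanced η φ) :=
  ((hc.isCompact.image continuous_fst).prod
    ((hc.isCompact.image continuous_snd).union hη.isCompact)).of_isClosed_subset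
    (isClosed_tsupport _) (tsupport_fiberBalanced_subset hη hc)

theorem tsupport_fiberBalanced_subset_Q (hη : HasCompactSupport η) (hηs : tsupport η ⊆ Ioo 0 Θ)
    (hc : HasCompactSupport φ) (hs : tsupport φ ⊆ Q Θ) : tsupport (fiberBalanced η φ) ⊆ Q Θ :=
  (tsupport_fiberBalanced_subset hη hc).trans <|
    prod_mono (image_subset_iff.2 fun _ hp => (hs hp).1)
      (union_subset (image_subset_iff.2 fun _ hp => (hs hp).2) hηs)

theorem exists_contDiff_tsupport_subset_Ioo_integral_eq_one {a b : ℝ} (hab : a < b) :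
    ∃ η : ℝ → ℝ, ContDiff ℝ ∞ η ∧ HasCompactSupport η ∧ tsupport η ⊆ Ioo a b ∧
      ∫ s, η s = 1 := by
  let bump : ContDiffBump ((a + b) / 2) := ⟨(b - a) / 4, (b - a) / 3, by linarith, by linarith⟩
  refine ⟨bump.normed volume, bump.contDiff_normed, bump.hasCompactSupport_normed, ?_,
    bump.integral_normed⟩
  rw [bump.tsupport_normed_eq, Real.closedBall_eq_Icc]
  exact Icc_subset_Ioo (by simp only [bump]; linarith) (by simp only [bump]; linarith)

end AngularTestFunction

section VanishingAngularDerivative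

theorem integral_sub_integral_mul {α : Type*} {mα : MeasurableSpace α} {μ : Measure α}
    {f φ η : α → ℝ} (hfφ : Integrable (fun x => f x * φ x) μ)
    (hfη : Integrable (fun x => f x * η x) μ) (hφ : Integrable φ μ) :
    ∫ x, (f x - ∫ y, f y * η y ∂μ) * φ x ∂μ = ∫ x, f x * (φ x - η x * ∫ y, φ y ∂μ) ∂μ := by
  simp only [sub_mul, mul_sub, ← mul_assoc]
  rw [integral_sub hfφ (hφ.const_mul _), integral_sub hfφ (hfη.mul_const _), integral_const_mul,
    integral_mul_const]

variable {Θ : ℝ} {f v g φ : ℝ × ℝ → ℝ} {η : ℝ → ℝ}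

theorem memL2_integral_fiber_mul (hf : MemL2 (Q Θ) wr f)
    (hη : MemLp η 2 (volume.restrict (Ioc 0 Θ))) :
    MemL2 (Q Θ) wr fun p => ∫ s in Ioc 0 Θ, f (p.1, s) * η s := by
  have hmeas : AEStronglyMeasurable (fun p : ℝ × ℝ => f p * η p.2)
      ((volume.restrict (Ioo 0 1)).prod (volume.restrict (Ioc 0 Θ))) :=
    (volume_restrict_Q Θ ▸ hf.1).mul hη.1.comp_snd
  set ν := volume.restrict (Ioc 0 Θ)
  refine (memL2_and_normL2_le_of_slices isWeight_radius
    (volume_restrict_Q Θ ▸ hmeas.integral_prod_right'.comp_fst) hf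
    (C := √(ν.real univ) * lpNorm η 2 ν) (mul_nonneg (Real.sqrt_nonneg _) lpNorm_nonneg) ?_).1
  filter_upwards [hf.ae_memLp_slice] with r hr
  refine ⟨memLp_const _, ?_⟩
  calc ∫ _, (∫ s, f (r, s) * η s ∂ν) ^ 2 ∂ν
      = ν.real univ * |∫ s, f (r, s) * η s ∂ν| ^ 2 := by rw [integral_const, smul_eq_mul, sq_abs]
    _ ≤ ν.real univ * (lpNorm (fun s => f (r, s)) 2 ν * lpNorm η 2 ν) ^ 2 := by
        gcongr
        exact abs_integral_mul_le_lpNorm_mul_lpNorm hr hη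
    _ = (√(ν.real univ) * lpNorm η 2 ν) ^ 2 * ∫ s, f (r, s) ^ 2 ∂ν := by
        rw [mul_pow, mul_pow, lpNorm_two_sq hr.1, Real.sq_sqrt (by positivity)]
        ring

theorem setIntegral_sub_integral_fiber_mul (hf : MemL2 (Q Θ) wr f)
    (hη : ContDiff ℝ ∞ η) (hηc : HasCompactSupport η) (hηs : tsupport η ⊆ Ioo 0 Θ)
    (hφ : ContDiff ℝ ∞ φ) (hc : HasCompactSupport φ) (hs : tsupport φ ⊆ Q Θ) :
    ∫ p in Q Θ, (f - fun p : ℝ × ℝ => ∫ s in Ioc 0 Θ, f (p.1, s) * η s) p * φ p =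
      ∫ p in Q Θ, f p * fiberBalanced η φ p := by
  have hηL2 : MemLp η 2 (volume.restrict (Ioc 0 Θ)) :=
    (hη.continuous.memLp_of_hasCompactSupport hηc).restrict _
  have hw := isWeight_wr Θ
  have hleft := (integrable_mul_of_tsupport_subset
    ((hf.sub hw (memL2_integral_fiber_mul hf hηL2)).locallyIntegrableOn hw)
    hφ.continuous hc hs).integrableOn (s := Q Θ)
  have hright := (integrable_mul_of_tsupport_subset (hf.locallyIntegrableOn hw)
    (contDiff_fiberBalanced hη hφ hc).continuous (hasCompactSupport_fiberBalanced hηc hc)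
    (tsupport_fiberBalanced_subset_Q hηc hηs hc hs)).integrableOn (s := Q Θ)
  rw [IntegrableOn, volume_restrict_Q] at hleft hright
  rw [volume_restrict_Q, integral_prod _ hleft, integral_prod _ hright]
  refine integral_congr_ae ?_
  filter_upwards [hf.ae_memLp_slice] with r hr
  have hφL2 : MemLp (fun s => φ (r, s)) 2 (volume.restrict (Ioc 0 Θ)) :=
    (Continuous.memLp_of_hasCompactSupport (by fun_prop) (hasCompactSupport_fiber hc r)).restrict _
  have hfiber : ∫ s, φ (r, s) = ∫ s in Ioc 0 Θ, φ (r, s) :=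
    (setIntegral_eq_integral_of_forall_compl_eq_zero fun s hsΘ =>
      image_eq_zero_of_notMem_tsupport fun hmem => hsΘ (Ioo_subset_Ioc_self (hs hmem).2)).symm
  simp only [fiberBalanced, Pi.sub_apply, hfiber]
  exact integral_sub_integral_mul (hr.integrable_mul hφL2) (hr.integrable_mul hηL2)
    (hφL2.integrable one_le_two)

theorem IsWeakDeriv.exists_ae_eq_comp_fst (hΘ : 0 < Θ) (hd : IsWeakDeriv (Q Θ) dirTheta f 0)
    (hf : MemL2 (Q Θ) wr f) :
    ∃ c : ℝ → ℝ, f =ᵐ[volume.restrict (Q Θ)] fun p => c p.1 := by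
  obtain ⟨η, hη, hηc, hηs, hη1⟩ := exists_contDiff_tsupport_subset_Ioo_integral_eq_one hΘ
  have hηL2 : MemLp η 2 (volume.restrict (Ioc 0 Θ)) :=
    (hη.continuous.memLp_of_hasCompactSupport hηc).restrict _
  have hloc := (hf.sub (isWeight_wr Θ) (memL2_integral_fiber_mul hf hηL2)).locallyIntegrableOn
    (isWeight_wr Θ)
  refine ⟨fun r => ∫ s in Ioc 0 Θ, f (r, s) * η s, ?_⟩
  suffices hzero : ∀ᵐ p, p ∈ Q Θ → (f - fun p : ℝ × ℝ => ∫ s in Ioc 0 Θ, f (p.1, s) * η s) p = 0 by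
    filter_upwards [(ae_restrict_iff' (isOpen_Q Θ).measurableSet).2 hzero] with p hp
    exact sub_eq_zero.1 hp
  refine (isOpen_Q Θ).ae_eq_zero_of_integral_contDiff_smul_eq_zero hloc fun φ hφ hc hs => ?_
  simp only [smul_eq_mul, mul_comm (φ _)]
  rw [← setIntegral_mul_eq_integral_of_tsupport_subset _ hs,
    setIntegral_sub_integral_fiber_mul hf hη hηc hηs hφ hc hs]
  exact hd.integral_mul_eq_zero (contDiff_fiberBalanced hη hφ hc)
    (hasCompactSupport_fiberBalanced hηc hc) (tsupport_fiberBalanced_subset_Q hηc hηs hc hs)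
    (integral_fiberBalanced (hη.continuous.integrable_of_hasCompactSupport hηc) hη1
      hφ.continuous hc)

theorem IsWeakDeriv.exists_isAngularTrace {ϑ : ℝ} (hd : IsWeakDeriv (Q Θ) dirTheta v g)
    (hΘ : 0 < Θ) (hϑ : ϑ ∈ Icc 0 Θ) (hv : MemL2 (Q Θ) wr v) (hg : MemL2 (Q Θ) wr g) :
    ∃ τ, IsAngularTrace Θ ϑ v g τ := by
  have h0 : (0 : ℝ) ∈ Icc 0 Θ := left_mem_Icc.2 hΘ.le
  have hprim := (memL2_and_normL2_angularPrimitive_le h0 hg).1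
  have htrace : IsAngularTrace Θ 0 (angularPrimitive 0 g) g 0 :=
    .of_forall fun p => (zero_add _).symm
  have hdiff : IsWeakDeriv (Q Θ) dirTheta (v - angularPrimitive 0 g) 0 := by
    simpa only [sub_self] using hd.sub (htrace.isWeakDeriv hΘ.le hprim hg)
  obtain ⟨c, hc⟩ := hdiff.exists_ae_eq_comp_fst hΘ (hv.sub (isWeight_wr Θ) hprim)
  have hcv : IsAngularTrace Θ 0 v g c := hc.mono fun p (hp : _ = c p.1) => by
    simp only [← hp, Pi.sub_apply, sub_add_cancel]
  exact ⟨_, hcv.change_base h0 hϑ hg⟩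

end VanishingAngularDerivative

section Smooth

variable {Θ : ℝ} {φ : ℝ × ℝ → ℝ}

theorem memL2_of_continuous {X : Type*} [TopologicalSpace X] [T2Space X] [MeasureSpace X]
    [OpensMeasurableSpace X] [IsFiniteMeasureOnCompacts (volume : Measure X)]
    {Ω K : Set X} {w v : X → ℝ} (hK : IsCompact K) (hΩ : Ω ⊆ K) (hw : Continuous w)
    (hv : Continuous v) : MemL2 Ω w v :=
  ⟨(hv.continuousOn.aestronglyMeasurable_of_isCompact hK hK.measurableSet).mono_set hΩ,
    (((hv.pow 2).mul hw).continuousOn.integrableOn_compact hK).mono_set hΩ⟩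

theorem memL2_wr_of_continuous (Θ : ℝ) (hφ : Continuous φ) : MemL2 (Q Θ) wr φ :=
  memL2_of_continuous (isCompact_Icc.prod isCompact_Icc)
    (prod_mono Ioo_subset_Icc_self Ioo_subset_Icc_self) continuous_fst hφ

theorem memL2_radius_of_continuous {τ : ℝ → ℝ} (hτ : Continuous τ) :
    MemL2 (Ioo 0 1) (fun r => r) τ :=
  memL2_of_continuous isCompact_Icc Ioo_subset_Icc_self continuous_id hτ

theorem contDiff_fderiv_apply (hφ : ContDiff ℝ ∞ φ) (e : ℝ × ℝ) :
    ContDiff ℝ ∞ fun p => fderiv ℝ φ p e :=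
  (hφ.fderiv_right (m := ∞) (by simp)).clm_apply contDiff_const

theorem hasDerivAt_radial (hφ : ContDiff ℝ ∞ φ) (r θ : ℝ) :
    HasDerivAt (fun s => φ (s, θ)) (fderiv ℝ φ (r, θ) dirR) r :=
  HasFDerivAt.comp_hasDerivAt r (hφ.differentiable (by simp) (r, θ)).hasFDerivAt
    ((hasDerivAt_id r).prodMk (hasDerivAt_const r θ))

theorem isWeakDeriv_radial_of_contDiff (hφ : ContDiff ℝ ∞ φ) (ϑ : ℝ) :
    IsWeakDeriv (Ioo 0 1) (1 : ℝ) (fun r => φ (r, ϑ)) fun r => fderiv ℝ φ (r, ϑ) dirR := by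
  have hsmooth : ContDiff ℝ ∞ fun r => φ (r, ϑ) := hφ.comp (contDiff_id.prodMk contDiff_const)
  refine (isWeakDeriv_of_contDiff hsmooth).congr (EventuallyEq.refl _ _) (ae_of_all _ fun r => ?_)
  exact fderiv_apply_one_eq_deriv.trans (hasDerivAt_radial hφ r ϑ).deriv

end Smooth

section Norms

variable {Θ : ℝ} {u v : ℝ × ℝ → ℝ}

theorem normL2_wr_le_normL2_wrInv (hv : MemL2 (Q Θ) wrInv v) :
    normL2 (Q Θ) wr v ≤ normL2 (Q Θ) wrInv v :=
  Real.sqrt_le_sqrt <| setIntegral_mono_on hv.wr_of_wrInv.2 hv.2 (isOpen_Q Θ).measurableSet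
    fun _ hp => mul_le_mul_of_nonneg_left (wr_le_wrInv hp) (sq_nonneg _)

theorem normH1_sq (Θ : ℝ) (v : ℝ × ℝ → ℝ) : normH1 Θ v ^ 2 = normL2 (Q Θ) wr v ^ 2
    + normL2 (Q Θ) wr (dR Θ v) ^ 2 + normL2 (Q Θ) wrInv (dTheta Θ v) ^ 2 :=
  Real.sq_sqrt (by positivity)

theorem normL2_le_normU :
    normL2 (Q Θ) wr v ≤ normU Θ v ∧ normL2 (Q Θ) wr (dR Θ v) ≤ normU Θ v ∧
      normL2 (Q Θ) wrInv (dTheta Θ v) ≤ normU Θ v ∧ normL2 (Q Θ) wr (dRTheta Θ v) ≤ normU Θ v := by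
  rw [normU, normH1_sq]
  refine ⟨?_, ?_, ?_, ?_⟩ <;> refine Real.le_sqrt_of_sq_le ?_ <;>
    linarith [sq_nonneg (normL2 (Q Θ) wr v), sq_nonneg (normL2 (Q Θ) wr (dR Θ v)),
      sq_nonneg (normL2 (Q Θ) wrInv (dTheta Θ v)), sq_nonneg (normL2 (Q Θ) wr (dRTheta Θ v))]

theorem normL2_le_normH1r (g : ℝ → ℝ) : normL2 (Ioo 0 1) (fun r => r) g ≤ normH1r g :=
  Real.le_sqrt_of_sq_le (le_add_of_nonneg_right (sq_nonneg _))

theorem MemU.isWeakDeriv_dTheta (hu : MemU Θ u) : IsWeakDeriv (Q Θ) dirTheta u (dTheta Θ u) :=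
  hu.1.2.2.1.isWeakDeriv_weakDeriv

theorem MemU.isWeakDeriv_dRTheta (hu : MemU Θ u) :
    IsWeakDeriv (Q Θ) dirTheta (dR Θ u) (dRTheta Θ u) :=
  hu.2.1.1.isWeakDeriv_weakDeriv

theorem MemU.memL2_wr (hu : MemU Θ u) : MemL2 (Q Θ) wr u := hu.1.1

theorem MemU.memL2_wr_dR (hu : MemU Θ u) : MemL2 (Q Θ) wr (dR Θ u) := hu.1.2.1.2

theorem MemU.memL2_wr_dTheta (hu : MemU Θ u) : MemL2 (Q Θ) wr (dTheta Θ u) :=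
  hu.1.2.2.2.wr_of_wrInv

theorem MemU.memL2_wr_dRTheta (hu : MemU Θ u) : MemL2 (Q Θ) wr (dRTheta Θ u) := hu.2.1.2

end Norms

section SmoothApproximation

variable {Θ : ℝ} {u : ℝ × ℝ → ℝ} {φ : ℕ → ℝ × ℝ → ℝ}

theorem tendsto_normL2_of_tendsto_normU (hlim : Tendsto (fun k => normU Θ (φ k - u)) atTop (𝓝 0)) :
    Tendsto (fun k => normL2 (Q Θ) wr (φ k - u)) atTop (𝓝 0) :=
  squeeze_zero (fun _ => normL2_nonneg) (fun _ => normL2_le_normU.1) hlim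

theorem dR_sub_ae_eq (hu : MemU Θ u) {ψ : ℝ × ℝ → ℝ} (hψ : ContDiff ℝ ∞ ψ) :
    dR Θ (ψ - u) =ᵐ[volume.restrict (Q Θ)] (fun p => fderiv ℝ ψ p dirR) - dR Θ u :=
  ((isWeakDeriv_of_contDiff hψ).sub hu.1.2.1.1.isWeakDeriv_weakDeriv).weakDeriv_ae_eq (isOpen_Q Θ)

theorem tendsto_normL2_dR_of_tendsto_normU (hu : MemU Θ u) (hφ : ∀ k, SmoothH1 Θ (φ k))
    (hlim : Tendsto (fun k => normU Θ (φ k - u)) atTop (𝓝 0)) :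
    Tendsto (fun k => normL2 (Q Θ) wr ((fun p => fderiv ℝ (φ k) p dirR) - dR Θ u))
      atTop (𝓝 0) := by
  refine squeeze_zero (fun _ => normL2_nonneg) (fun k => ?_) hlim
  rw [← normL2_congr (dR_sub_ae_eq hu (hφ k).1)]
  exact normL2_le_normU.2.1

theorem tendsto_normL2_dTheta_of_tendsto_normU (hu : MemU Θ u) (hφ : ∀ k, SmoothH1 Θ (φ k))
    (hlim : Tendsto (fun k => normU Θ (φ k - u)) atTop (𝓝 0)) :
    Tendsto (fun k => normL2 (Q Θ) wr ((fun p => fderiv ℝ (φ k) p dirTheta) - dTheta Θ u))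
      atTop (𝓝 0) := by
  refine squeeze_zero (fun _ => normL2_nonneg) (fun k => ?_) hlim
  have hdiff : dTheta Θ (φ k - u) =ᵐ[volume.restrict (Q Θ)] dTheta Θ (φ k) - dTheta Θ u :=
    weakDeriv_sub_ae_eq (isOpen_Q Θ) (hφ k).2.2.2.1 hu.1.2.2.1
  have hclassical : dTheta Θ (φ k) =ᵐ[volume.restrict (Q Θ)] fun p => fderiv ℝ (φ k) p dirTheta :=
    (isWeakDeriv_of_contDiff (hφ k).1).weakDeriv_ae_eq (isOpen_Q Θ)
  have hmem : MemL2 (Q Θ) wrInv (dTheta Θ (φ k - u)) :=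
    ((hφ k).2.2.2.2.sub (isWeight_wrInv Θ) hu.1.2.2.2).congr hdiff.symm
  rw [← normL2_congr (hdiff.trans (hclassical.sub (EventuallyEq.refl _ _)))]
  exact (normL2_wr_le_normL2_wrInv hmem).trans normL2_le_normU.2.2.1

theorem tendsto_normL2_dRTheta_of_tendsto_normU (hu : MemU Θ u) (hφ : ∀ k, SmoothH1 Θ (φ k))
    (hlim : Tendsto (fun k => normU Θ (φ k - u)) atTop (𝓝 0)) :
    Tendsto (fun k => normL2 (Q Θ) wr
      ((fun p => fderiv ℝ (fun q => fderiv ℝ (φ k) q dirR) p dirTheta) - dRTheta Θ u))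
      atTop (𝓝 0) := by
  refine squeeze_zero (fun _ => normL2_nonneg) (fun k => ?_) hlim
  have hweak := ((isWeakDeriv_of_contDiff (contDiff_fderiv_apply (hφ k).1 dirR)).sub
    hu.isWeakDeriv_dRTheta).congr (dR_sub_ae_eq hu (hφ k).1).symm (EventuallyEq.refl _ _)
  rw [← normL2_congr (hweak.weakDeriv_ae_eq (isOpen_Q Θ))]
  exact normL2_le_normU.2.2.2

end SmoothApproximation

section RadialTrace

variable {Θ ϑ : ℝ} {u v g : ℝ × ℝ → ℝ} {τ σ γ : ℝ → ℝ} {φ : ℕ → ℝ × ℝ → ℝ}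

theorem IsAngularTrace.tendsto_normL2_sub (h : IsAngularTrace Θ ϑ v g τ) (hΘ : 0 < Θ)
    (hϑ : ϑ ∈ Icc 0 Θ) (hv : MemL2 (Q Θ) wr v) (hg : MemL2 (Q Θ) wr g)
    (hφ : ∀ k, ContDiff ℝ ∞ (φ k))
    (hlim : Tendsto (fun k => normL2 (Q Θ) wr (φ k - v)) atTop (𝓝 0))
    (hlim' : Tendsto (fun k => normL2 (Q Θ) wr ((fun p => fderiv ℝ (φ k) p dirTheta) - g))
      atTop (𝓝 0)) :
    Tendsto (fun k => normL2 (Ioo 0 1) (fun r => r) ((fun r => φ k (r, ϑ)) - τ))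
      atTop (𝓝 0) := by
  have hle (k : ℕ) := ((isAngularTrace_of_contDiff (hφ k) Θ ϑ).sub h hϑ
    (memL2_wr_of_continuous Θ (continuous_fderiv_apply_const (hφ k) _)) hg).sqrt_mul_normL2_le hϑ
    ((memL2_wr_of_continuous Θ (hφ k).continuous).sub (isWeight_wr Θ) hv)
    ((memL2_wr_of_continuous Θ (continuous_fderiv_apply_const (hφ k) _)).sub (isWeight_wr Θ) hg)
  refine squeeze_zero (fun _ => normL2_nonneg)
    (fun k => (le_div_iff₀' (Real.sqrt_pos.2 hΘ)).2 (hle k)) ?_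
  simpa using (hlim.add (hlim'.const_mul Θ)).div_const √Θ

namespace MemU

theorem tendsto_normL2_trace (hu : MemU Θ u) (hΘ : 0 < Θ) (hϑ : ϑ ∈ Icc 0 Θ)
    (hτ : IsAngularTrace Θ ϑ u (dTheta Θ u) τ) (hφ : ∀ k, SmoothH1 Θ (φ k))
    (hlim : Tendsto (fun k => normU Θ (φ k - u)) atTop (𝓝 0)) :
    Tendsto (fun k => normL2 (Ioo 0 1) (fun r => r) ((fun r => φ k (r, ϑ)) - τ))
      atTop (𝓝 0) :=
  hτ.tendsto_normL2_sub hΘ hϑ hu.memL2_wr hu.memL2_wr_dTheta (fun k => (hφ k).1)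
    (tendsto_normL2_of_tendsto_normU hlim) (tendsto_normL2_dTheta_of_tendsto_normU hu hφ hlim)

theorem tendsto_normL2_dR_trace (hu : MemU Θ u) (hΘ : 0 < Θ) (hϑ : ϑ ∈ Icc 0 Θ)
    (hσ : IsAngularTrace Θ ϑ (dR Θ u) (dRTheta Θ u) σ) (hφ : ∀ k, SmoothH1 Θ (φ k))
    (hlim : Tendsto (fun k => normU Θ (φ k - u)) atTop (𝓝 0)) :
    Tendsto (fun k => normL2 (Ioo 0 1) (fun r => r) ((fun r => fderiv ℝ (φ k) (r, ϑ) dirR) - σ))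
      atTop (𝓝 0) :=
  hσ.tendsto_normL2_sub (φ := fun k p => fderiv ℝ (φ k) p dirR) hΘ hϑ hu.memL2_wr_dR
    hu.memL2_wr_dRTheta
    (fun k => contDiff_fderiv_apply (hφ k).1 dirR)
    (tendsto_normL2_dR_of_tendsto_normU hu hφ hlim)
    (tendsto_normL2_dRTheta_of_tendsto_normU hu hφ hlim)

theorem isWeakDeriv_angularTrace (hu : MemU Θ u) (hΘ : 0 < Θ) (hϑ : ϑ ∈ Icc 0 Θ)
    (hτ : IsAngularTrace Θ ϑ u (dTheta Θ u) τ)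
    (hσ : IsAngularTrace Θ ϑ (dR Θ u) (dRTheta Θ u) σ) : IsWeakDeriv (Ioo 0 1) (1 : ℝ) τ σ := by
  obtain ⟨φ, hφ, hlim⟩ := hu.2.2
  exact IsWeakDeriv.of_tendsto isWeight_radius
    (fun k => isWeakDeriv_radial_of_contDiff (hφ k).1 ϑ)
    (fun k => memL2_radius_of_continuous ((hφ k).1.continuous.comp (by fun_prop)))
    (hτ.memL2 hΘ hϑ hu.memL2_wr hu.memL2_wr_dTheta)
    (fun k => memL2_radius_of_continuous
      ((continuous_fderiv_apply_const (hφ k).1 dirR).comp (by fun_prop)))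
    (hσ.memL2 hΘ hϑ hu.memL2_wr_dR hu.memL2_wr_dRTheta)
    (hu.tendsto_normL2_trace hΘ hϑ hτ hφ hlim) (hu.tendsto_normL2_dR_trace hΘ hϑ hσ hφ hlim)

theorem isRadialTrace_of_isAngularTrace (hu : MemU Θ u) (hΘ : 0 < Θ) (hϑ : ϑ ∈ Icc 0 Θ)
    (hτ : IsAngularTrace Θ ϑ u (dTheta Θ u) τ)
    (hσ : IsAngularTrace Θ ϑ (dR Θ u) (dRTheta Θ u) σ) : IsRadialTrace Θ ϑ u τ := by
  have hτσ := hu.isWeakDeriv_angularTrace hΘ hϑ hτ hσ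
  have hτmem := hτ.memL2 hΘ hϑ hu.memL2_wr hu.memL2_wr_dTheta
  have hσmem := hσ.memL2 hΘ hϑ hu.memL2_wr_dR hu.memL2_wr_dRTheta
  obtain ⟨φ, hφ, hlim⟩ := hu.2.2
  refine ⟨hu, ⟨hτmem, ⟨σ, hτσ⟩, hσmem.congr (hτσ.weakDeriv_ae_eq isOpen_Ioo).symm⟩,
    φ, hφ, hlim, ?_⟩
  have hderiv (k : ℕ) : weakDeriv (Ioo 0 1) (1 : ℝ) ((fun r => φ k (r, ϑ)) - τ)
      =ᵐ[volume.restrict (Ioo 0 1)] (fun r => fderiv ℝ (φ k) (r, ϑ) dirR) - σ :=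
    ((isWeakDeriv_radial_of_contDiff (hφ k).1 ϑ).sub hτσ).weakDeriv_ae_eq isOpen_Ioo
  have hnorm := (((hu.tendsto_normL2_trace hΘ hϑ hτ hφ hlim).pow 2).add
    ((hu.tendsto_normL2_dR_trace hΘ hϑ hσ hφ hlim).pow 2)).sqrt
  rw [zero_pow two_ne_zero, add_zero, Real.sqrt_zero] at hnorm
  exact hnorm.congr fun k => by rw [← normL2_congr (hderiv k)]; rfl

theorem exists_isAngularTrace (hu : MemU Θ u) (hΘ : 0 < Θ) (hϑ : ϑ ∈ Icc 0 Θ) :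
    ∃ τ σ, IsAngularTrace Θ ϑ u (dTheta Θ u) τ ∧
      IsAngularTrace Θ ϑ (dR Θ u) (dRTheta Θ u) σ := by
  obtain ⟨τ, hτ⟩ := hu.isWeakDeriv_dTheta.exists_isAngularTrace hΘ hϑ hu.memL2_wr
    hu.memL2_wr_dTheta
  obtain ⟨σ, hσ⟩ := hu.isWeakDeriv_dRTheta.exists_isAngularTrace hΘ hϑ hu.memL2_wr_dR
    hu.memL2_wr_dRTheta
  exact ⟨τ, σ, hτ, hσ⟩

theorem isRadialTrace_radialTrace (hu : MemU Θ u) (hΘ : 0 < Θ) (hϑ : ϑ ∈ Icc 0 Θ) :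
    IsRadialTrace Θ ϑ u (radialTrace Θ ϑ u) := by
  obtain ⟨τ, σ, hτ, hσ⟩ := hu.exists_isAngularTrace hΘ hϑ
  have hex : ∃ γ, IsRadialTrace Θ ϑ u γ := ⟨τ, hu.isRadialTrace_of_isAngularTrace hΘ hϑ hτ hσ⟩
  rw [radialTrace, dif_pos hex]
  exact hex.choose_spec

end MemU

theorem IsRadialTrace.ae_eq_of_isAngularTrace (h : IsRadialTrace Θ ϑ u γ) (hΘ : 0 < Θ)
    (hϑ : ϑ ∈ Icc 0 Θ) (hτ : IsAngularTrace Θ ϑ u (dTheta Θ u) τ) :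
    τ =ᵐ[volume.restrict (Ioo 0 1)] γ := by
  obtain ⟨hu, ⟨hγ, -⟩, φ, hφ, hlim, hlimγ⟩ := h
  exact ae_eq_of_tendsto_normL2_sub isWeight_radius
    (fun k => memL2_radius_of_continuous ((hφ k).1.continuous.comp (by fun_prop)))
    (hτ.memL2 hΘ hϑ hu.memL2_wr hu.memL2_wr_dTheta) hγ
    (hu.tendsto_normL2_trace hΘ hϑ hτ hφ hlim)
    (squeeze_zero (fun _ => normL2_nonneg) (fun _ => normL2_le_normH1r _) hlimγ)

theorem IsRadialTrace.isAngularTrace (h : IsRadialTrace Θ ϑ u γ) (hΘ : 0 < Θ)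
    (hϑ : ϑ ∈ Icc 0 Θ) :
    IsAngularTrace Θ ϑ u (dTheta Θ u) γ ∧
      IsAngularTrace Θ ϑ (dR Θ u) (dRTheta Θ u) (weakDeriv (Ioo 0 1) (1 : ℝ) γ) := by
  obtain ⟨τ, σ, hτ, hσ⟩ := h.1.exists_isAngularTrace hΘ hϑ
  have hτγ := h.ae_eq_of_isAngularTrace hΘ hϑ hτ
  have hγσ := (h.1.isWeakDeriv_angularTrace hΘ hϑ hτ hσ).congr hτγ (EventuallyEq.refl _ _)
  exact ⟨hτ.congr hϑ (EventuallyEq.refl _ _) hτγ,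
    hσ.congr hϑ (EventuallyEq.refl _ _) (hγσ.weakDeriv_ae_eq isOpen_Ioo).symm⟩

end RadialTrace

namespace AngularPartition

variable {Θ : ℝ} (T : AngularPartition Θ) {i j : ℕ} {θ : ℝ}

section Nodes

theorem node_strictMonoOn : StrictMonoOn T.node (Iic T.n) :=
  strictMonoOn_of_lt_add_one ordConnected_Iic fun i _ _ hi => T.node_lt i (Nat.lt_of_succ_le hi)

theorem node_mono (hij : i ≤ j) (hj : j ≤ T.n) : T.node i ≤ T.node j :=
  T.node_strictMonoOn.monotoneOn (mem_Iic.2 (hij.trans hj)) (mem_Iic.2 hj) hij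

theorem node_mem_Icc (hi : i ≤ T.n) : T.node i ∈ Icc 0 Θ :=
  ⟨T.node_zero.symm.trans_le (T.node_mono (Nat.zero_le i) hi),
    (T.node_mono hi le_rfl).trans_eq T.node_last⟩

theorem zero_mem_Icc (T : AngularPartition Θ) : (0 : ℝ) ∈ Icc 0 Θ :=
  T.node_zero ▸ T.node_mem_Icc (Nat.zero_le _)

theorem width_pos (hi : i < T.n) : 0 < T.node (i + 1) - T.node i :=
  sub_pos.2 (T.node_lt i hi)

theorem width_le_meshSize (hi : i < T.n) : T.node (i + 1) - T.node i ≤ T.meshSize :=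
  le_ciSup (f := fun i : Fin T.n => T.node ((i : ℕ) + 1) - T.node (i : ℕ))
    (finite_range _).bddAbove ⟨i, hi⟩

theorem meshSize_nonneg : 0 ≤ T.meshSize :=
  Real.iSup_nonneg fun i => (T.width_pos i.2).le

theorem meshSize_le : T.meshSize ≤ Θ := by
  refine Real.iSup_le (fun i => ?_) T.zero_mem_Icc.2
  linarith [(T.node_mem_Icc (Nat.succ_le_of_lt i.2)).2, (T.node_mem_Icc i.2.le).1]

/-- The half-open cell `(θ_i, θ_{i+1}]` of the partition; the cells are disjoint and cover
`(0, Θ]`. -/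
def element (i : ℕ) : Set ℝ := Ioc (T.node i) (T.node (i + 1))

theorem measurableSet_element (i : ℕ) : MeasurableSet (T.element i) := measurableSet_Ioc

theorem volume_element_ne_top (i : ℕ) : volume (T.element i) ≠ ⊤ := measure_Ioc_lt_top.ne

theorem element_subset (hi : i < T.n) : T.element i ⊆ Ioc 0 Θ :=
  Ioc_subset_Ioc (T.node_mem_Icc hi.le).1 (T.node_mem_Icc (Nat.succ_le_of_lt hi)).2

theorem exists_mem_element (hθ : θ ∈ Ioc 0 Θ) : ∃ i < T.n, θ ∈ T.element i := by
  have exists_of_le_node (m : ℕ) (hm : m ≤ T.n) (h : θ ≤ T.node m) :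
      ∃ i < T.n, θ ∈ T.element i := by
    induction m with
    | zero => exact absurd (h.trans_eq T.node_zero) (not_le.2 hθ.1)
    | succ m ih =>
      by_cases hθm : θ ≤ T.node m
      · exact ih (Nat.le_of_succ_le hm) hθm
      · exact ⟨m, hm, not_le.1 hθm, h⟩
  exact exists_of_le_node T.n le_rfl (hθ.2.trans_eq T.node_last.symm)

theorem notMem_element (hi : i < T.n) (hj : j < T.n) (hij : i ≠ j) (hθ : θ ∈ T.element j) :
    θ ∉ T.element i := by
  intro h
  rcases lt_or_gt_of_ne hij with hlt | hlt
  · exact absurd (h.2.trans (T.node_mono hlt hj.le)) (not_le.2 hθ.1)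
  · exact absurd (hθ.2.trans (T.node_mono hlt hi.le)) (not_le.2 h.1)

theorem setIntegral_eq_sum {F : ℝ → ℝ} (hF : IntegrableOn F (Ioc 0 Θ)) :
    ∫ t in Ioc 0 Θ, F t = ∑ i ∈ Finset.range T.n, ∫ t in T.element i, F t := by
  have hint (i : ℕ) (hi : i < T.n) :
      IntervalIntegrable F volume (T.node i) (T.node (i + 1)) :=
    (intervalIntegrable_iff_integrableOn_Ioc_of_le (T.node_lt i hi).le).2
      (hF.mono_set (T.element_subset hi))
  rw [← intervalIntegral.integral_of_le T.zero_mem_Icc.2]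
  calc ∫ t in (0 : ℝ)..Θ, F t
      = ∑ i ∈ Finset.range T.n, ∫ t in T.node i..T.node (i + 1), F t := by
        rw [intervalIntegral.sum_integral_adjacent_intervals hint, T.node_zero, T.node_last]
    _ = ∑ i ∈ Finset.range T.n, ∫ t in T.element i, F t :=
        Finset.sum_congr rfl fun i hi =>
          intervalIntegral.integral_of_le (T.node_lt i (Finset.mem_range.1 hi)).le

theorem setIntegral_le_of_element {F G : ℝ → ℝ} {K : ℝ} (hF : IntegrableOn F (Ioc 0 Θ))
    (hG : IntegrableOn G (Ioc 0 Θ))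
    (h : ∀ i < T.n, ∫ t in T.element i, F t ≤ K * ∫ t in T.element i, G t) :
    ∫ t in Ioc 0 Θ, F t ≤ K * ∫ t in Ioc 0 Θ, G t := by
  rw [T.setIntegral_eq_sum hF, T.setIntegral_eq_sum hG, Finset.mul_sum]
  exact Finset.sum_le_sum fun i hi => h i (Finset.mem_range.1 hi)

end Nodes

section Hat

theorem hat_left (hj : j < T.n) (hθ : θ ∈ T.element j) :
    T.hat j θ = (T.node (j + 1) - θ) / (T.node (j + 1) - T.node j) := by
  have hw := T.width_pos hj
  have h_nonneg : 0 ≤ (T.node (j + 1) - θ) / (T.node (j + 1) - T.node j) :=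
    div_nonneg (sub_nonneg.2 hθ.2) hw.le
  have h_le_one : (T.node (j + 1) - θ) / (T.node (j + 1) - T.node j) ≤ 1 :=
    (div_le_one hw).2 (by linarith [hθ.1])
  rw [hat, if_neg hj.ne, min_eq_right, max_eq_right h_nonneg]
  split_ifs with hj0
  · exact h_le_one
  · have hw' := T.width_pos (i := j - 1) (by omega)
    rw [Nat.sub_add_cancel (Nat.pos_of_ne_zero hj0)] at hw'
    exact h_le_one.trans ((one_le_div hw').2 (by linarith [hθ.1]))

theorem hat_right (hj : j < T.n) (hθ : θ ∈ T.element j) :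
    T.hat (j + 1) θ = (θ - T.node j) / (T.node (j + 1) - T.node j) := by
  have hw := T.width_pos hj
  have h_nonneg : 0 ≤ (θ - T.node j) / (T.node (j + 1) - T.node j) :=
    div_nonneg (sub_nonneg.2 hθ.1.le) hw.le
  have h_le_one : (θ - T.node j) / (T.node (j + 1) - T.node j) ≤ 1 :=
    (div_le_one hw).2 (by linarith [hθ.2])
  rw [hat, if_neg (Nat.succ_ne_zero j), Nat.add_sub_cancel, min_eq_left, max_eq_right h_nonneg]
  split_ifs with hjn
  · exact h_le_one
  · exact h_le_one.trans ((one_le_div (T.width_pos (by omega))).2 (by linarith [hθ.2]))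

theorem hat_eq_zero (hi : i ≤ T.n) (hj : j < T.n) (hij : i ≠ j) (hij' : i ≠ j + 1)
    (hθ : θ ∈ T.element j) : T.hat i θ = 0 := by
  rw [hat, max_eq_left]
  rcases lt_or_gt_of_ne hij with hlt | hgt
  · refine (min_le_right _ _).trans ?_
    rw [if_neg (by omega)]
    refine div_nonpos_of_nonpos_of_nonneg ?_ (T.width_pos (by omega)).le
    linarith [hθ.1, T.node_mono (i := i + 1) hlt hj.le]
  · refine (min_le_left _ _).trans ?_
    have hw := T.width_pos (i := i - 1) (by omega)
    rw [Nat.sub_add_cancel (by omega)] at hw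
    rw [if_neg (by omega)]
    refine div_nonpos_of_nonpos_of_nonneg ?_ hw.le
    linarith [hθ.2, T.node_mono (i := j + 1) (j := i - 1) (by omega) (by omega)]

theorem sum_mul_hat (hj : j < T.n) (hθ : θ ∈ T.element j) (p : ℕ → ℝ) :
    ∑ i ∈ Finset.range (T.n + 1), p i * T.hat i θ
      = p j + (p (j + 1) - p j) / (T.node (j + 1) - T.node j) * (θ - T.node j) := by
  rw [Finset.sum_eq_add_of_mem j (j + 1) (Finset.mem_range.2 (by omega))
    (Finset.mem_range.2 (by omega)) (by omega), T.hat_left hj hθ, T.hat_right hj hθ]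
  · have := (T.width_pos hj).ne'
    field_simp
    ring
  · intro i hi hne
    rw [T.hat_eq_zero (Nat.lt_succ_iff.1 (Finset.mem_range.1 hi)) hj hne.1 hne.2 hθ, mul_zero]

theorem continuous_hat (i : ℕ) : Continuous (T.hat i) := by
  unfold hat
  refine continuous_const.max (Continuous.min ?_ ?_) <;> split_ifs <;> fun_prop

end Hat

section PiecewiseAverage

variable {f g : ℝ → ℝ} {k : ℝ}

/-- The piecewise constant function whose value on each element is the average of `f` there. -/
noncomputable def piecewiseAverage (f : ℝ → ℝ) (t : ℝ) : ℝ :=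
  ∑ i ∈ Finset.range T.n, (T.element i).indicator (fun _ => ⨍ s in T.element i, f s) t

theorem piecewiseAverage_eq (f : ℝ → ℝ) (hj : j < T.n) (hθ : θ ∈ T.element j) :
    T.piecewiseAverage f θ = ⨍ s in T.element j, f s := by
  rw [piecewiseAverage, Finset.sum_eq_single_of_mem j (Finset.mem_range.2 hj),
    indicator_of_mem hθ]
  intro i hi hij
  rw [indicator_of_notMem (T.notMem_element (Finset.mem_range.1 hi) hj hij hθ)]

theorem memLp_element (hf : MemLp f 2 (volume.restrict (Ioc 0 Θ))) (hi : i < T.n) :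
    MemLp f 2 (volume.restrict (T.element i)) :=
  hf.mono_measure (Measure.restrict_mono_set _ (T.element_subset hi))

theorem memLp_sub_piecewiseAverage (hf : MemLp f 2 (volume.restrict (Ioc 0 Θ))) :
    MemLp (fun t => f t - T.piecewiseAverage f t) 2 (volume.restrict (Ioc 0 Θ)) :=
  hf.sub (memLp_finsetSum _ fun i _ => (memLp_const _).indicator (T.measurableSet_element i))

theorem setIntegral_sub_piecewiseAverage (f : ℝ → ℝ) (hi : i < T.n) :
    ∫ t in T.element i, (f t - T.piecewiseAverage f t) = 0 := by
  have := isFiniteMeasure_restrict.2 (T.volume_element_ne_top i)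
  rw [setIntegral_congr_fun (T.measurableSet_element i) fun t ht =>
    congrArg (f t - ·) (T.piecewiseAverage_eq f hi ht)]
  exact integral_sub_average _ f

theorem intervalIntegral_sub_piecewiseAverage_node
    (hf : MemLp f 2 (volume.restrict (Ioc 0 Θ))) (hi : i ≤ T.n) :
    ∫ t in (0 : ℝ)..T.node i, (f t - T.piecewiseAverage f t) = 0 := by
  have hdev := T.memLp_sub_piecewiseAverage hf
  induction i with
  | zero => rw [T.node_zero, intervalIntegral.integral_same]
  | succ i ih =>
    have hi' : i < T.n := hi
    rw [← intervalIntegral.integral_add_adjacent_intervals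
      (intervalIntegrable_of_memLp hdev T.zero_mem_Icc (T.node_mem_Icc hi'.le))
      (intervalIntegrable_of_memLp hdev (T.node_mem_Icc hi'.le) (T.node_mem_Icc hi)),
      ih hi'.le, zero_add, intervalIntegral.integral_of_le (T.node_lt i hi').le]
    exact T.setIntegral_sub_piecewiseAverage f hi'

theorem intervalIntegral_sub_piecewiseAverage_eq_node
    (hf : MemLp f 2 (volume.restrict (Ioc 0 Θ))) (hi : i ≤ T.n) (hθ : θ ∈ Icc 0 Θ) :
    ∫ t in (0 : ℝ)..θ, (f t - T.piecewiseAverage f t)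
      = ∫ t in T.node i..θ, (f t - T.piecewiseAverage f t) := by
  have hdev := T.memLp_sub_piecewiseAverage hf
  rw [← intervalIntegral.integral_add_adjacent_intervals
    (intervalIntegrable_of_memLp hdev T.zero_mem_Icc (T.node_mem_Icc hi))
    (intervalIntegrable_of_memLp hdev (T.node_mem_Icc hi) hθ),
    T.intervalIntegral_sub_piecewiseAverage_node hf hi, zero_add]

theorem intervalIntegral_sub_piecewiseAverage_of_mem_element
    (hf : MemLp f 2 (volume.restrict (Ioc 0 Θ))) (hj : j < T.n) (hθ : θ ∈ T.element j) :
    ∫ t in T.node j..θ, (f t - T.piecewiseAverage f t)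
      = (∫ t in T.node j..θ, f t) - (⨍ s in T.element j, f s) * (θ - T.node j) := by
  have hmem : θ ∈ Icc 0 Θ := Ioc_subset_Icc_self (T.element_subset hj hθ)
  have hcongr : ∫ t in T.node j..θ, (f t - T.piecewiseAverage f t)
      = ∫ t in T.node j..θ, (f t - ⨍ s in T.element j, f s) := by
    rw [intervalIntegral.integral_of_le hθ.1.le, intervalIntegral.integral_of_le hθ.1.le]
    exact setIntegral_congr_fun measurableSet_Ioc fun t ht =>
      congrArg (f t - ·) (T.piecewiseAverage_eq f hj ⟨ht.1, ht.2.trans hθ.2⟩)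
  rw [hcongr, intervalIntegral.integral_sub
    (intervalIntegrable_of_memLp hf (T.node_mem_Icc hj.le) hmem) intervalIntegrable_const,
    intervalIntegral.integral_const, smul_eq_mul, mul_comm]

theorem sub_sum_mul_hat_eq_intervalIntegral {p : ℕ → ℝ} {a : ℝ}
    (hf : MemLp f 2 (volume.restrict (Ioc 0 Θ))) (hθ : θ ∈ Ioc 0 Θ)
    (hp : ∀ i ≤ T.n, a = p i + ∫ t in T.node i..θ, f t) :
    a - ∑ i ∈ Finset.range (T.n + 1), p i * T.hat i θ
      = ∫ t in (0 : ℝ)..θ, (f t - T.piecewiseAverage f t) := by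
  obtain ⟨j, hj, hθj⟩ := T.exists_mem_element hθ
  have hmem : θ ∈ Icc 0 Θ := Ioc_subset_Icc_self hθ
  have hincr : p (j + 1) - p j = ∫ t in T.node j..T.node (j + 1), f t := by
    have hsplit := intervalIntegral.integral_add_adjacent_intervals
      (intervalIntegrable_of_memLp hf (T.node_mem_Icc hj.le) (T.node_mem_Icc hj))
      (intervalIntegrable_of_memLp hf (T.node_mem_Icc hj) hmem)
    linarith [hp j hj.le, hp (j + 1) hj]
  have hslope :
      (p (j + 1) - p j) / (T.node (j + 1) - T.node j) = ⨍ s in T.element j, f s := by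
    rw [hincr, intervalIntegral.integral_of_le (T.node_lt j hj).le, setAverage_eq, element,
      Real.volume_real_Ioc_of_le (T.node_lt j hj).le, smul_eq_mul, div_eq_inv_mul]
  rw [T.sum_mul_hat hj hθj, hslope, T.intervalIntegral_sub_piecewiseAverage_eq_node hf hj.le hmem,
    T.intervalIntegral_sub_piecewiseAverage_of_mem_element hf hj hθj, hp j hj.le]
  ring

theorem setIntegral_element_sq_sub_piecewiseAverage_le
    (hf : MemLp f 2 (volume.restrict (Ioc 0 Θ))) (hi : i < T.n) (k : ℝ) :
    ∫ t in T.element i, (f t - T.piecewiseAverage f t) ^ 2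
      ≤ ∫ t in T.element i, (f t - k) ^ 2 := by
  have := isFiniteMeasure_restrict.2 (T.volume_element_ne_top i)
  rw [setIntegral_congr_fun (T.measurableSet_element i) fun t ht =>
    congrArg (fun a => (f t - a) ^ 2) (T.piecewiseAverage_eq f hi ht)]
  exact integral_sub_average_sq (T.memLp_element hf hi) k

theorem setIntegral_element_sq_primitive_le (hg : MemLp g 2 (volume.restrict (Ioc 0 Θ)))
    (hi : i < T.n) :
    ∫ θ in T.element i, (∫ t in T.node i..θ, g t) ^ 2
      ≤ T.meshSize ^ 2 * ∫ t in T.element i, g t ^ 2 := by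
  have hle : (T.node (i + 1) - T.node i) ^ 2 ≤ T.meshSize ^ 2 :=
    pow_le_pow_left₀ (T.width_pos hi).le (T.width_le_meshSize hi) 2
  exact (integral_sq_primitive_le (T.memLp_element hg hi)
    (left_mem_Icc.2 (T.node_lt i hi).le)).trans
      (mul_le_mul_of_nonneg_right hle (integral_nonneg fun _ => sq_nonneg _))

theorem setIntegral_sq_sub_piecewiseAverage_le (hf : MemLp f 2 (volume.restrict (Ioc 0 Θ))) :
    ∫ t in Ioc 0 Θ, (f t - T.piecewiseAverage f t) ^ 2 ≤ ∫ t in Ioc 0 Θ, f t ^ 2 := by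
  rw [← one_mul (∫ t in Ioc 0 Θ, f t ^ 2)]
  refine T.setIntegral_le_of_element (T.memLp_sub_piecewiseAverage hf).integrable_sq
    hf.integrable_sq fun i hi => ?_
  simpa only [sub_zero, one_mul] using T.setIntegral_element_sq_sub_piecewiseAverage_le hf hi 0

theorem setIntegral_sq_sub_piecewiseAverage_le_of_ae_eq_primitive
    (hf : MemLp f 2 (volume.restrict (Ioc 0 Θ))) (hg : MemLp g 2 (volume.restrict (Ioc 0 Θ)))
    (h : ∀ᵐ θ ∂volume.restrict (Ioc 0 Θ), f θ = k + ∫ t in (0 : ℝ)..θ, g t) :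
    ∫ t in Ioc 0 Θ, (f t - T.piecewiseAverage f t) ^ 2
      ≤ T.meshSize ^ 2 * ∫ t in Ioc 0 Θ, g t ^ 2 := by
  refine T.setIntegral_le_of_element (T.memLp_sub_piecewiseAverage hf).integrable_sq
    hg.integrable_sq fun i hi => ?_
  have hnode : (fun θ => (f θ - (k + ∫ t in (0 : ℝ)..T.node i, g t)) ^ 2)
      =ᵐ[volume.restrict (T.element i)] fun θ => (∫ t in T.node i..θ, g t) ^ 2 := by
    filter_upwards [ae_restrict_of_ae_restrict_of_subset (T.element_subset hi) h,
      ae_restrict_mem (T.measurableSet_element i)] with θ hθ hmem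
    rw [hθ, ← intervalIntegral.integral_add_adjacent_intervals
      (intervalIntegrable_of_memLp hg T.zero_mem_Icc (T.node_mem_Icc hi.le))
      (intervalIntegrable_of_memLp hg (T.node_mem_Icc hi.le)
        (Ioc_subset_Icc_self (T.element_subset hi hmem)))]
    ring
  exact (T.setIntegral_element_sq_sub_piecewiseAverage_le hf hi _).trans
    ((integral_congr_ae hnode).trans_le (T.setIntegral_element_sq_primitive_le hg hi))

theorem setIntegral_sq_primitive_sub_piecewiseAverage_le
    (hf : MemLp f 2 (volume.restrict (Ioc 0 Θ))) :
    ∫ θ in Ioc 0 Θ, (∫ t in (0 : ℝ)..θ, (f t - T.piecewiseAverage f t)) ^ 2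
      ≤ T.meshSize ^ 2 * ∫ t in Ioc 0 Θ, (f t - T.piecewiseAverage f t) ^ 2 := by
  have hdev := T.memLp_sub_piecewiseAverage hf
  refine T.setIntegral_le_of_element (memLp_primitive hdev T.zero_mem_Icc).integrable_sq
    hdev.integrable_sq fun i hi => ?_
  rw [setIntegral_congr_fun (T.measurableSet_element i) fun θ hθ =>
    congrArg (· ^ 2) (T.intervalIntegral_sub_piecewiseAverage_eq_node hf hi.le
      (Ioc_subset_Icc_self (T.element_subset hi hθ)))]
  exact T.setIntegral_element_sq_primitive_le hdev hi

end PiecewiseAverage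

end AngularPartition

section ProductWeakDerivative

theorem locallyIntegrableOn_mul_prod {α β : Type*} [TopologicalSpace α] [TopologicalSpace β]
    [MeasureSpace α] [MeasureSpace β] [SFinite (volume : Measure α)]
    [SFinite (volume : Measure β)] {I : Set α} {J : Set β} {τ : α → ℝ} {η : β → ℝ}
    (hτ : LocallyIntegrableOn τ I) (hη : LocallyIntegrableOn η J) :
    LocallyIntegrableOn (fun p : α × β => τ p.1 * η p.2) (I ×ˢ J) := by
  rintro ⟨x, y⟩ ⟨hx, hy⟩
  obtain ⟨s, hs, hτs⟩ := hτ x hx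
  obtain ⟨t, ht, hηt⟩ := hη y hy
  refine ⟨s ×ˢ t, nhdsWithin_prod hs ht, ?_⟩
  rw [IntegrableOn, Measure.volume_eq_prod, ← Measure.prod_restrict]
  exact Integrable.mul_prod hτs hηt

variable {I J : Set ℝ} {τ σ η : ℝ → ℝ} {φ : ℝ × ℝ → ℝ}

theorem IsWeakDeriv.setIntegral_slice (h : IsWeakDeriv I (1 : ℝ) τ σ) (hφ : ContDiff ℝ ∞ φ)
    (hc : HasCompactSupport φ) (hs : tsupport φ ⊆ I ×ˢ J) (θ : ℝ) :
    ∫ r in I, τ r * fderiv ℝ φ (r, θ) dirR = -∫ r in I, σ r * φ (r, θ) := by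
  have hK : IsCompact (Prod.fst '' tsupport φ) := hc.isCompact.image continuous_fst
  have hzero : ∀ r ∉ Prod.fst '' tsupport φ, φ (r, θ) = 0 := fun r hr =>
    image_eq_zero_of_notMem_tsupport fun hmem => hr ⟨_, hmem, rfl⟩
  have hsub : tsupport (fun r => φ (r, θ)) ⊆ I :=
    (closure_minimal (fun r hr => not_imp_comm.1 (hzero r) hr) hK.isClosed).trans
      (image_subset_iff.2 fun p hp => (hs hp).1)
  have hslice := h.2.2 (fun r => φ (r, θ)) (hφ.comp (contDiff_id.prodMk contDiff_const))
    (HasCompactSupport.intro hK hzero) hsub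
  simpa only [fderiv_apply_one_eq_deriv, (hasDerivAt_radial hφ _ θ).deriv] using hslice

theorem IsWeakDeriv.mul_prod (h : IsWeakDeriv I (1 : ℝ) τ σ) (hη : LocallyIntegrableOn η J) :
    IsWeakDeriv (I ×ˢ J) dirR (fun p => τ p.1 * η p.2) fun p => σ p.1 * η p.2 := by
  have hτη := locallyIntegrableOn_mul_prod h.1 hη
  have hση := locallyIntegrableOn_mul_prod h.2.1 hη
  refine ⟨hτη, hση, fun φ hφ hc hs => ?_⟩
  have hint := (integrable_mul_of_tsupport_subset hτη (continuous_fderiv_apply_const hφ dirR)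
    (hc.fderiv_apply ℝ _) ((tsupport_fderiv_apply_subset ℝ _).trans hs)).integrableOn (s := I ×ˢ J)
  have hint' := (integrable_mul_of_tsupport_subset hση hφ.continuous hc hs).integrableOn
    (s := I ×ˢ J)
  rw [IntegrableOn, Measure.volume_eq_prod, ← Measure.prod_restrict] at hint hint'
  rw [Measure.volume_eq_prod, ← Measure.prod_restrict, integral_prod_symm _ hint,
    integral_prod_symm _ hint', ← integral_neg]
  refine integral_congr_ae (ae_of_all _ fun θ => ?_)
  simp only [mul_right_comm _ (η θ), integral_mul_const, h.setIntegral_slice hφ hc hs, neg_mul]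

end ProductWeakDerivative

namespace AngularPartition

variable {Θ : ℝ} (T : AngularPartition Θ) {v g b e : ℝ × ℝ → ℝ} {τ σ : ℕ → ℝ → ℝ}

/-- The deviation of `g` from its averages in the angular variable over the elements of the
partition. -/
noncomputable def averageDeviation (g : ℝ × ℝ → ℝ) (p : ℝ × ℝ) : ℝ :=
  g p - T.piecewiseAverage (fun t => g (p.1, t)) p.2

/-- The function that is piecewise linear in the angular variable with prescribed values `τ i` at
the nodes. The interpolant of `u` is the case `τ i = γ_{θ_i} u`. -/
noncomputable def nodalInterpolant (τ : ℕ → ℝ → ℝ) (p : ℝ × ℝ) : ℝ :=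
  ∑ i ∈ Finset.range (T.n + 1), τ i p.1 * T.hat i p.2

theorem aestronglyMeasurable_averageDeviation
    (hg : AEStronglyMeasurable g (volume.restrict (Q Θ))) :
    AEStronglyMeasurable (T.averageDeviation g) (volume.restrict (Q Θ)) := by
  rw [volume_restrict_Q] at hg ⊢
  refine hg.sub (Finset.aestronglyMeasurable_fun_sum _ fun i hi => ?_)
  have hgi : AEStronglyMeasurable g
      ((volume.restrict (Ioo (0 : ℝ) 1)).prod (volume.restrict (T.element i))) :=
    hg.mono_measure (Measure.prod_mono le_rfl
      (Measure.restrict_mono_set _ (T.element_subset (Finset.mem_range.1 hi))))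
  have havg : AEStronglyMeasurable (fun r => ⨍ s in T.element i, g (r, s))
      (volume.restrict (Ioo 0 1)) := by
    simp only [setAverage_eq, smul_eq_mul]
    exact hgi.integral_prod_right'.const_mul _
  exact havg.comp_fst.indicator (measurable_snd (T.measurableSet_element i))

theorem memL2_and_normL2_averageDeviation_le (hg : MemL2 (Q Θ) wr g) :
    MemL2 (Q Θ) wr (T.averageDeviation g) ∧
      normL2 (Q Θ) wr (T.averageDeviation g) ≤ normL2 (Q Θ) wr g := by
  rw [← one_mul (normL2 (Q Θ) wr g)]
  refine memL2_and_normL2_le_of_slices isWeight_radius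
    (T.aestronglyMeasurable_averageDeviation hg.1) hg zero_le_one ?_
  filter_upwards [hg.ae_memLp_slice] with r hr
  rw [one_pow, one_mul]
  exact ⟨T.memLp_sub_piecewiseAverage hr, T.setIntegral_sq_sub_piecewiseAverage_le hr⟩

theorem memL2_and_normL2_averageDeviation_le_of_isAngularTrace {τ : ℝ → ℝ}
    (h : IsAngularTrace Θ 0 b e τ) (hb : MemL2 (Q Θ) wr b) (he : MemL2 (Q Θ) wrInv e) :
    MemL2 (Q Θ) wrInv (T.averageDeviation b) ∧
      normL2 (Q Θ) wrInv (T.averageDeviation b) ≤ T.meshSize * normL2 (Q Θ) wrInv e := by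
  refine memL2_and_normL2_le_of_slices isWeight_one_div_radius
    (T.aestronglyMeasurable_averageDeviation hb.1) he T.meshSize_nonneg ?_
  filter_upwards [hb.ae_memLp_slice, he.wr_of_wrInv.ae_memLp_slice, ae_ae_of_ae_Q h]
    with r hbr her hr
  exact ⟨T.memLp_sub_piecewiseAverage hbr,
    T.setIntegral_sq_sub_piecewiseAverage_le_of_ae_eq_primitive hbr her hr⟩

theorem memL2_and_normL2_angularPrimitive_averageDeviation_le (hg : MemL2 (Q Θ) wr g) :
    MemL2 (Q Θ) wr (angularPrimitive 0 (T.averageDeviation g)) ∧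
      normL2 (Q Θ) wr (angularPrimitive 0 (T.averageDeviation g))
        ≤ T.meshSize * normL2 (Q Θ) wr (T.averageDeviation g) := by
  have hdev := (T.memL2_and_normL2_averageDeviation_le hg).1
  refine memL2_and_normL2_le_of_slices isWeight_radius
    (aestronglyMeasurable_angularPrimitive T.zero_mem_Icc hdev.1) hdev T.meshSize_nonneg ?_
  filter_upwards [hg.ae_memLp_slice] with r hr
  exact ⟨memLp_primitive (T.memLp_sub_piecewiseAverage hr) T.zero_mem_Icc,
    T.setIntegral_sq_primitive_sub_piecewiseAverage_le hr⟩

theorem isAngularTrace_sub_nodalInterpolant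
    (h : ∀ i ≤ T.n, IsAngularTrace Θ (T.node i) v g (τ i)) (hg : MemL2 (Q Θ) wr g) :
    IsAngularTrace Θ 0 (v - T.nodalInterpolant τ) (T.averageDeviation g) 0 := by
  have hnodes : ∀ᵐ p ∂volume.restrict (Q Θ), ∀ i ≤ T.n,
      v p = τ i p.1 + angularPrimitive (T.node i) g p :=
    ae_all_iff.2 fun i => eventually_imp_distrib_left.2 (h i)
  filter_upwards [hnodes, ae_Q_of_ae_radius hg.ae_memLp_slice Θ,
    ae_restrict_mem (isOpen_Q Θ).measurableSet] with p hp hgp hpQ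
  rw [Pi.zero_apply, zero_add]
  exact T.sub_sum_mul_hat_eq_intervalIntegral hgp (Ioo_subset_Ioc_self hpQ.2) hp

theorem memL2_and_normL2_sub_nodalInterpolant_le
    (h : ∀ i ≤ T.n, IsAngularTrace Θ (T.node i) v g (τ i)) (hg : MemL2 (Q Θ) wr g) :
    MemL2 (Q Θ) wr (v - T.nodalInterpolant τ) ∧
      normL2 (Q Θ) wr (v - T.nodalInterpolant τ)
        ≤ T.meshSize * normL2 (Q Θ) wr (T.averageDeviation g) := by
  have hae : v - T.nodalInterpolant τ =ᵐ[volume.restrict (Q Θ)]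
      angularPrimitive 0 (T.averageDeviation g) :=
    (T.isAngularTrace_sub_nodalInterpolant h hg).mono fun p hp => hp.trans (zero_add _)
  obtain ⟨hmem, hle⟩ := T.memL2_and_normL2_angularPrimitive_averageDeviation_le hg
  exact ⟨hmem.congr hae.symm, (normL2_congr hae).trans_le hle⟩

theorem isWeakDeriv_nodalInterpolant (h : ∀ i ≤ T.n, IsWeakDeriv (Ioo 0 1) (1 : ℝ) (τ i) (σ i)) :
    IsWeakDeriv (Q Θ) dirR (T.nodalInterpolant τ) (T.nodalInterpolant σ) := by
  have hsum := IsWeakDeriv.sum (Finset.range (T.n + 1)) fun i hi =>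
    (h i (Nat.lt_succ_iff.1 (Finset.mem_range.1 hi))).mul_prod
      ((T.continuous_hat i).locallyIntegrable.locallyIntegrableOn (Ioo 0 Θ))
  have hsum_eq (ρ : ℕ → ℝ → ℝ) : T.nodalInterpolant ρ =
      ∑ i ∈ Finset.range (T.n + 1), fun p : ℝ × ℝ => ρ i p.1 * T.hat i p.2 := by
    ext p
    rw [nodalInterpolant, Finset.sum_apply]
  rwa [hsum_eq, hsum_eq]

end AngularPartition

section Interpolation

variable {Θ : ℝ} {u v : ℝ × ℝ → ℝ}

theorem MemH1.sub (hu : MemH1 Θ u) (hv : MemH1 Θ v) : MemH1 Θ (u - v) := by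
  obtain ⟨hu₀, ⟨hur, hur₂⟩, huθ, huθ₂⟩ := hu
  obtain ⟨hv₀, ⟨hvr, hvr₂⟩, hvθ, hvθ₂⟩ := hv
  exact ⟨hu₀.sub (isWeight_wr Θ) hv₀,
    ⟨⟨_, hur.isWeakDeriv_weakDeriv.sub hvr.isWeakDeriv_weakDeriv⟩,
      (hur₂.sub (isWeight_wr Θ) hvr₂).congr (weakDeriv_sub_ae_eq (isOpen_Q Θ) hur hvr).symm⟩,
    ⟨_, huθ.isWeakDeriv_weakDeriv.sub hvθ.isWeakDeriv_weakDeriv⟩,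
    (huθ₂.sub (isWeight_wrInv Θ) hvθ₂).congr (weakDeriv_sub_ae_eq (isOpen_Q Θ) huθ hvθ).symm⟩

variable (T : AngularPartition Θ)

namespace MemU

theorem isRadialTrace_node (hu : MemU Θ u) (hΘ : 0 < Θ) (i : ℕ) (hi : i ≤ T.n) :
    IsRadialTrace Θ (T.node i) u (radialTrace Θ (T.node i) u) :=
  hu.isRadialTrace_radialTrace hΘ (T.node_mem_Icc hi)

theorem isAngularTrace_node (hu : MemU Θ u) (hΘ : 0 < Θ) (i : ℕ) (hi : i ≤ T.n) :
    IsAngularTrace Θ (T.node i) u (dTheta Θ u) (radialTrace Θ (T.node i) u) ∧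
      IsAngularTrace Θ (T.node i) (dR Θ u) (dRTheta Θ u)
        (weakDeriv (Ioo 0 1) (1 : ℝ) (radialTrace Θ (T.node i) u)) :=
  (hu.isRadialTrace_node T hΘ i hi).isAngularTrace hΘ (T.node_mem_Icc hi)

theorem memL2_and_normL2_sub_interpolant_le (hu : MemU Θ u) (hΘ : 0 < Θ) :
    MemL2 (Q Θ) wr (u - interpolant T u) ∧
      normL2 (Q Θ) wr (u - interpolant T u)
        ≤ T.meshSize * normL2 (Q Θ) wr (T.averageDeviation (dTheta Θ u)) :=
  T.memL2_and_normL2_sub_nodalInterpolant_le (fun i hi => (hu.isAngularTrace_node T hΘ i hi).1)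
    hu.memL2_wr_dTheta

theorem isWeakDeriv_radial_sub_interpolant (hu : MemU Θ u) (hΘ : 0 < Θ) :
    IsWeakDeriv (Q Θ) dirR (u - interpolant T u)
      (dR Θ u - T.nodalInterpolant fun i =>
        weakDeriv (Ioo 0 1) (1 : ℝ) (radialTrace Θ (T.node i) u)) :=
  hu.1.2.1.1.isWeakDeriv_weakDeriv.sub <| T.isWeakDeriv_nodalInterpolant fun i hi =>
    (hu.isRadialTrace_node T hΘ i hi).2.1.2.1.isWeakDeriv_weakDeriv

theorem memL2_and_normL2_dR_sub_interpolant_le (hu : MemU Θ u) (hΘ : 0 < Θ) :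
    MemL2 (Q Θ) wr (dR Θ (u - interpolant T u)) ∧
      normL2 (Q Θ) wr (dR Θ (u - interpolant T u))
        ≤ T.meshSize * normL2 (Q Θ) wr (dRTheta Θ u) := by
  have hae : dR Θ (u - interpolant T u) =ᵐ[volume.restrict (Q Θ)] _ :=
    (hu.isWeakDeriv_radial_sub_interpolant T hΘ).weakDeriv_ae_eq (isOpen_Q Θ)
  obtain ⟨hmem, hle⟩ := T.memL2_and_normL2_sub_nodalInterpolant_le
    (fun i hi => (hu.isAngularTrace_node T hΘ i hi).2) hu.memL2_wr_dRTheta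
  exact ⟨hmem.congr hae.symm, (normL2_congr hae).trans_le <| hle.trans <|
    mul_le_mul_of_nonneg_left (T.memL2_and_normL2_averageDeviation_le hu.memL2_wr_dRTheta).2
      T.meshSize_nonneg⟩

theorem isWeakDeriv_angular_sub_interpolant (hu : MemU Θ u) (hΘ : 0 < Θ) :
    IsWeakDeriv (Q Θ) dirTheta (u - interpolant T u) (T.averageDeviation (dTheta Θ u)) :=
  (T.isAngularTrace_sub_nodalInterpolant (fun i hi => (hu.isAngularTrace_node T hΘ i hi).1)
    hu.memL2_wr_dTheta).isWeakDeriv hΘ.le (hu.memL2_and_normL2_sub_interpolant_le T hΘ).1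
      (T.memL2_and_normL2_averageDeviation_le hu.memL2_wr_dTheta).1

end MemU

namespace MemU'

theorem memL2_and_normL2_averageDeviation_dTheta_le (hu : MemU' Θ u) (hΘ : 0 < Θ) :
    MemL2 (Q Θ) wrInv (T.averageDeviation (dTheta Θ u)) ∧
      normL2 (Q Θ) wrInv (T.averageDeviation (dTheta Θ u))
        ≤ T.meshSize * normL2 (Q Θ) wrInv (dThetaTheta Θ u) := by
  obtain ⟨hU, hdiff, hθθ⟩ := hu
  obtain ⟨τ, hτ⟩ := hdiff.isWeakDeriv_weakDeriv.exists_isAngularTrace hΘ T.zero_mem_Icc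
    hU.memL2_wr_dTheta hθθ.wr_of_wrInv
  exact T.memL2_and_normL2_averageDeviation_le_of_isAngularTrace hτ hU.memL2_wr_dTheta hθθ

theorem normL2_sub_interpolant_le (hu : MemU' Θ u) (hΘ : 0 < Θ) :
    normL2 (Q Θ) wr (u - interpolant T u)
      ≤ T.meshSize ^ 2 * normL2 (Q Θ) wrInv (dThetaTheta Θ u) := by
  obtain ⟨hmem, hle⟩ := hu.memL2_and_normL2_averageDeviation_dTheta_le T hΘ
  have hh := T.meshSize_nonneg
  calc normL2 (Q Θ) wr (u - interpolant T u)
      ≤ T.meshSize * normL2 (Q Θ) wr (T.averageDeviation (dTheta Θ u)) :=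
        (hu.1.memL2_and_normL2_sub_interpolant_le T hΘ).2
    _ ≤ T.meshSize * normL2 (Q Θ) wrInv (T.averageDeviation (dTheta Θ u)) := by
        gcongr
        exact normL2_wr_le_normL2_wrInv hmem
    _ ≤ T.meshSize * (T.meshSize * normL2 (Q Θ) wrInv (dThetaTheta Θ u)) := by gcongr
    _ = T.meshSize ^ 2 * normL2 (Q Θ) wrInv (dThetaTheta Θ u) := by ring

theorem memL2_and_normL2_dTheta_sub_interpolant_le (hu : MemU' Θ u) (hΘ : 0 < Θ) :
    MemL2 (Q Θ) wrInv (dTheta Θ (u - interpolant T u)) ∧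
      normL2 (Q Θ) wrInv (dTheta Θ (u - interpolant T u))
        ≤ T.meshSize * normL2 (Q Θ) wrInv (dThetaTheta Θ u) := by
  have hae : dTheta Θ (u - interpolant T u) =ᵐ[volume.restrict (Q Θ)] _ :=
    (hu.1.isWeakDeriv_angular_sub_interpolant T hΘ).weakDeriv_ae_eq (isOpen_Q Θ)
  obtain ⟨hmem, hle⟩ := hu.memL2_and_normL2_averageDeviation_dTheta_le T hΘ
  exact ⟨hmem.congr hae.symm, (normL2_congr hae).trans_le hle⟩

theorem memH1_interpolant (hu : MemU' Θ u) (hΘ : 0 < Θ) : MemH1 Θ (interpolant T u) := by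
  have herr : MemH1 Θ (u - interpolant T u) :=
    ⟨(hu.1.memL2_and_normL2_sub_interpolant_le T hΘ).1,
      ⟨⟨_, hu.1.isWeakDeriv_radial_sub_interpolant T hΘ⟩,
        (hu.1.memL2_and_normL2_dR_sub_interpolant_le T hΘ).1⟩,
      ⟨_, hu.1.isWeakDeriv_angular_sub_interpolant T hΘ⟩,
      (hu.memL2_and_normL2_dTheta_sub_interpolant_le T hΘ).1⟩
  simpa only [sub_sub_cancel] using hu.1.1.sub herr

theorem normH1_sub_interpolant_sq_le (hu : MemU' Θ u) (hΘ : 0 < Θ) :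
    normH1 Θ (u - interpolant T u) ^ 2 ≤ T.meshSize ^ 2 * (T.meshSize ^ 2 + 4) *
      (normL2 (Q Θ) wr (dRTheta Θ u) ^ 2 + normL2 (Q Θ) wrInv (dThetaTheta Θ u) ^ 2) := by
  set D := normL2 (Q Θ) wr (dRTheta Θ u)
  set E := normL2 (Q Θ) wrInv (dThetaTheta Θ u)
  set h := T.meshSize
  calc normH1 Θ (u - interpolant T u) ^ 2
      ≤ (h ^ 2 * E) ^ 2 + (h * D) ^ 2 + (h * E) ^ 2 := by
        rw [normH1_sq]
        gcongr
        · exact normL2_nonneg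
        · exact hu.normL2_sub_interpolant_le T hΘ
        · exact normL2_nonneg
        · exact (hu.1.memL2_and_normL2_dR_sub_interpolant_le T hΘ).2
        · exact normL2_nonneg
        · exact (hu.memL2_and_normL2_dTheta_sub_interpolant_le T hΘ).2
    _ ≤ h ^ 2 * (h ^ 2 + 4) * (D ^ 2 + E ^ 2) := by
        have : 0 ≤ h ^ 2 * (h ^ 2 * D ^ 2 + 3 * (D ^ 2 + E ^ 2)) := by positivity
        linarith

theorem normH1_sub_interpolant_le (hu : MemU' Θ u) (hΘ : 0 < Θ) :
    normH1 Θ (u - interpolant T u) ≤ √(Θ ^ 2 + 4) * T.meshSize *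
      √(normL2 (Q Θ) wr (dRTheta Θ u) ^ 2 + normL2 (Q Θ) wrInv (dThetaTheta Θ u) ^ 2) := by
  have hh := T.meshSize_nonneg
  refine abs_le_of_sq_le_sq' ?_ (by positivity) |>.2
  rw [mul_pow, mul_pow, Real.sq_sqrt (by positivity), Real.sq_sqrt (by positivity),
    mul_comm (Θ ^ 2 + 4)]
  refine (hu.normH1_sub_interpolant_sq_le T hΘ).trans ?_
  gcongr
  exact T.meshSize_le

end MemU'

end Interpolation

end SBFEM

theorem mainTheorem1_general (Θ : ℝ) (hΘ : 0 < Θ) :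
    ∃ C : ℝ, 0 < C ∧
      ∀ u : ℝ × ℝ → ℝ, SBFEM.MemU' Θ u →
      ∀ T : SBFEM.AngularPartition Θ,
        (∀ i ≤ T.n, SBFEM.IsRadialTrace Θ (T.node i) u (SBFEM.radialTrace Θ (T.node i) u)) ∧
        SBFEM.MemH1 Θ (SBFEM.interpolant T u) ∧
        SBFEM.normL2 (SBFEM.Q Θ) SBFEM.wr (u - SBFEM.interpolant T u)
          ≤ T.meshSize ^ 2 * SBFEM.normL2 (SBFEM.Q Θ) SBFEM.wrInv (SBFEM.dThetaTheta Θ u) ∧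
        SBFEM.normH1 Θ (u - SBFEM.interpolant T u)
          ≤ C * T.meshSize *
            Real.sqrt (SBFEM.normL2 (SBFEM.Q Θ) SBFEM.wr (SBFEM.dRTheta Θ u) ^ 2
              + SBFEM.normL2 (SBFEM.Q Θ) SBFEM.wrInv (SBFEM.dThetaTheta Θ u) ^ 2) ∧
        SBFEM.normH1 Θ (u - SBFEM.interpolant T u) ^ 2
          ≤ T.meshSize ^ 2 * (T.meshSize ^ 2 + 4) *
            (SBFEM.normL2 (SBFEM.Q Θ) SBFEM.wr (SBFEM.dRTheta Θ u) ^ 2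
              + SBFEM.normL2 (SBFEM.Q Θ) SBFEM.wrInv (SBFEM.dThetaTheta Θ u) ^ 2) :=
  ⟨√(Θ ^ 2 + 4), by positivity, fun _ hu T =>
    ⟨hu.1.isRadialTrace_node T hΘ, hu.memH1_interpolant T hΘ, hu.normL2_sub_interpolant_le T hΘ,
      hu.normH1_sub_interpolant_le T hΘ, hu.normH1_sub_interpolant_sq_le T hΘ⟩⟩

theorem mainTheorem1 (Θ : ℝ) (hΘ : 0 < Θ) (hΘ' : Θ < 2 * Real.pi) :
    ∃ C : ℝ, 0 < C ∧
      ∀ u : ℝ × ℝ → ℝ, SBFEM.MemU' Θ u →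
      ∀ T : SBFEM.AngularPartition Θ,
        (∀ i ≤ T.n, SBFEM.IsRadialTrace Θ (T.node i) u (SBFEM.radialTrace Θ (T.node i) u)) ∧
        SBFEM.MemH1 Θ (SBFEM.interpolant T u) ∧
        SBFEM.normL2 (SBFEM.Q Θ) SBFEM.wr (u - SBFEM.interpolant T u)
          ≤ T.meshSize ^ 2 * SBFEM.normL2 (SBFEM.Q Θ) SBFEM.wrInv (SBFEM.dThetaTheta Θ u) ∧
        SBFEM.normH1 Θ (u - SBFEM.interpolant T u)
          ≤ C * T.meshSize *
            Real.sqrt (SBFEM.normL2 (SBFEM.Q Θ) SBFEM.wr (SBFEM.dRTheta Θ u) ^ 2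
              + SBFEM.normL2 (SBFEM.Q Θ) SBFEM.wrInv (SBFEM.dThetaTheta Θ u) ^ 2) ∧
        SBFEM.normH1 Θ (u - SBFEM.interpolant T u) ^ 2
          ≤ T.meshSize ^ 2 * (T.meshSize ^ 2 + 4) *
            (SBFEM.normL2 (SBFEM.Q Θ) SBFEM.wr (SBFEM.dRTheta Θ u) ^ 2
              + SBFEM.normL2 (SBFEM.Q Θ) SBFEM.wrInv (SBFEM.dThetaTheta Θ u) ^ 2) :=
  mainTheorem1_general Θ hΘ
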